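/- Let $N,M,L\ge 1$ and $1\le k\le N$ be integers, let $\bm\xi_1,\dots,\bm\xi_M\in\mathbb R^N$ have sample mean $\hat{\bm\mu}=\frac1M\sum_m\bm\xi_m$ and sample covariance matrix $\hat{\bm\Sigma}=\frac1M\sum_m(\bm\xi_m-\hat{\bm\mu})(\bm\xi_m-\hat{\bm\mu})^\top$, and let $a^{(\ell)},b^{(\ell)}\in\mathbb R$ ($\ell=1,\dots,L$), $\gamma>0$, $\kappa_2\ge 1$. Assume $\kappa_1>0$ and $\hat{\bm\Sigma}\succ\bm O$. Let $\bm z\in\{0,1\}^N$ with $\sum_n z_n=k$, put $\bm Z=\mathrm{Diag}(\bm z)$, write $\bm A\bullet\bm B=\sum_{i,j}A_{ij}B_{ij}$, and let $f(\bm z)$ be the optimal value of the lower-level problem $$\begin{aligned}\min_{\bm x,\bm P,\bm Q,\bm p,\bm q,r,s}\ &\tfrac1{2\gamma}\bm x^\top\bm x+(\kappa_2\hat{\bm\Sigma}-\hat{\bm\mu}\hat{\bm\mu}^\top)\bullet\bm Q+r+\hat{\bm\Sigma}\bullet\bm P-2\hat{\bm\mu}^\top\bm p+\kappa_1 s\\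 \text{s.t. }&\bm p=-\bm q/2-\bm Q\hat{\bm\mu},\quad \begin{pmatrix}\bm Q&\bm q/2+a^{(\ell)}\bm Z\bm x/2\\(\bm q/2+a^{(\ell)}\bm Z\bm x/2)^\top&r+b^{(\ell)}\end{pmatrix}\succeq\bm O\ (\forall\ell),\\ &\begin{pmatrix}\bm P&\bm p\\\bm p^\top&s\end{pmatrix}\succeq\bm O,\quad \bm 1^\top\bm Z\bm x=1,\ \bm Z\bm x\ge\bm 0,\end{aligned}$$ over $\bm x,\bm p,\bm q\in\mathbb R^N$, symmetric $\bm P,\bm Q\in\mathbb R^{N\times N}$ and $r,s\in\mathbb R$. Consider also the problem $$\begin{aligned}\max_{\bm\omega,\bm B,\bm\beta,\bm\eta,\bm\lambda,\pi}\ &-\tfrac\gamma2\bm z^\top(\bm\omega\circ\bm\omega)-\sum_\ell\eta^{(\ell)}b^{(\ell)}+\pi\\ \text{s.t. }&\bm\omega\ge\sum_\ell a^{(\ell)}\bm\beta^{(\ell)}+\pi\bm 1,\quad \sum_\ell\bm\beta^{(\ell)}=\bm\lambda+\hat{\bm\mu},\quad 1-\sum_\ell\eta^{(\ell)}=0,\\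 &\sum_\ell\bm B^{(\ell)}=\kappa_2\hat{\bm\Sigma}-\hat{\bm\mu}\hat{\bm\mu}^\top+\hat{\bm\mu}\Big(\sum_\ell\bm\beta^{(\ell)}\Big)^\top+\Big(\sum_\ell\bm\beta^{(\ell)}\Big)\hat{\bm\mu}^\top,\\ &\begin{pmatrix}\bm B^{(\ell)}&\bm\beta^{(\ell)}\\(\bm\beta^{(\ell)})^\top&\eta^{(\ell)}\end{pmatrix}\succeq\bm O\ (\forall\ell),\quad \begin{pmatrix}\hat{\bm\Sigma}&\bm\lambda\\\bm\lambda^\top&\kappa_1\end{pmatrix}\succeq\bm O,\end{aligned}$$ over $\bm\omega,\bm\lambda,\bm\beta^{(\ell)}\in\mathbb R^N$, $\bm B^{(\ell)}\in\mathbb R^{N\times N}$, $\bm\eta\in\mathbb R^L$, $\pi\in\mathbb R$, where $\circ$ is the entrywise product. Then strong duality holds for the lower-level problem and the second problem is its dual, that is: (i) The minimum and the maximum are both attained, and both equal $f(\bm z)$. (ii) Form the Lagrange function of the lower-level problem by subtracting from its objective the terms $\bm\alpha^\top(\bm p+\bm q/2+\bm Q\hat{\bm\mu})$, $\begin{pmatrix}\bm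 B^{(\ell)}&\bm\beta^{(\ell)}\\(\bm\beta^{(\ell)})^\top&\eta^{(\ell)}\end{pmatrix}\bullet\begin{pmatrix}\bm Q&\bm q/2+a^{(\ell)}\bm Z\bm x/2\\(\bm q/2+a^{(\ell)}\bm Z\bm x/2)^\top&r+b^{(\ell)}\end{pmatrix}$ for all $\ell$, $\begin{pmatrix}\bm\Lambda&\bm\lambda\\\bm\lambda^\top&\nu\end{pmatrix}\bullet\begin{pmatrix}\bm P&\bm p\\\bm p^\top&s\end{pmatrix}$, $\pi(\bm 1^\top\bm Z\bm x-1)$ and $\bm\rho^\top\bm Z\bm x$, where $\bm\alpha\in\mathbb R^N$ and $\pi\in\mathbb R$ are free, the multiplier matrices of the semidefinite constraints are positive semidefinite, and $\bm\rho\ge\bm 0$; let $g\in[-\infty,\infty)$ be its infimum over all primal variables, as a function of the multipliers. The Lagrange dual $\max g$ over these multipliers is attained and also equals $f(\bm z)$. The map sending multipliers $(\bm\alpha,\bm B,\bm\beta,\bm\eta,\bm\Lambda,\bm\lambda,\nu,\pi,\bm\rho)$ to $(\bm\omega,\bm B,\bm\beta,\bm\eta,\bm\lambda,\pi)$ with $\bm\omega=\sum_\ell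 a^{(\ell)}\bm\beta^{(\ell)}+\pi\bm 1+\bm\rho$ is a bijection from the multipliers with $g>-\infty$ onto the feasible set of the second problem, and it carries $g$ to the objective of that problem. -/

import Mathlib

open Matrix

namespace DRPortfolio

/-- Sample mean `(1/M) ∑ₘ ξₘ` of `M` observed return vectors in `ℝ^N`. -/
noncomputable def sampleMean {N M : ℕ} (ξ : Fin M → Fin N → ℝ) : Fin N → ℝ :=
  (1 / (M : ℝ)) • ∑ m, ξ m

/-- Sample covariance matrix `(1/M) ∑ₘ (ξₘ - μ̂)(ξₘ - μ̂)ᵀ`. -/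
noncomputable def sampleCov {N M : ℕ} (ξ : Fin M → Fin N → ℝ) : Matrix (Fin N) (Fin N) ℝ :=
  (1 / (M : ℝ)) • ∑ m, vecMulVec (ξ m - sampleMean ξ) (ξ m - sampleMean ξ)

/-- The input data of the portfolio problem: `N` assets, `M` observed returns `ξ`, the `L` slopes
`a` and intercepts `b` of the piecewise-linear utility `y ↦ min_ℓ (a ℓ * y + b ℓ)`, the uncertainty
parameters `κ₁`, `κ₂` and the regularization parameter `γ`. -/
structure Data (N M L : ℕ) where
  ξ : Fin M → Fin N → ℝ
  a : Fin L → ℝ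
  b : Fin L → ℝ
  κ₁ : ℝ
  κ₂ : ℝ
  γ : ℝ

/-- The portfolios without short selling: nonnegative weights summing to one. -/
def portfolios (N : ℕ) : Set (Fin N → ℝ) :=
  {x | ∑ n, x n = 1 ∧ ∀ n, 0 ≤ x n}

/-- The 0-1 vectors with exactly `k` ones. -/
def selections (N k : ℕ) : Set (Fin N → ℝ) :=
  {z | (∀ n, z n = 0 ∨ z n = 1) ∧ ∑ n, z n = (k : ℝ)}

/-- The inner product `A • B = ∑ᵢⱼ Aᵢⱼ Bᵢⱼ` of matrices. -/
def matInner {ι : Type} [Fintype ι] (A B : Matrix ι ι ℝ) : ℝ :=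
  ∑ i, ∑ j, A i j * B i j

/-- The bordered matrix with blocks `A`, `u`, `uᵀ`, `c`. -/
def bordered {N : ℕ} (A : Matrix (Fin N) (Fin N) ℝ) (u : Fin N → ℝ) (c : ℝ) :
    Matrix (Fin N ⊕ Unit) (Fin N ⊕ Unit) ℝ :=
  fromBlocks A (replicateCol Unit u) (replicateRow Unit u) (of fun _ _ => c)

/-- The variables of the lower-level problem; `P` and `Q` range over symmetric matrices. -/
structure PrimalVar (N : ℕ) where
  x : Fin N → ℝ
  P : Matrix (Fin N) (Fin N) ℝ
  Q : Matrix (Fin N) (Fin N) ℝ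
  p : Fin N → ℝ
  q : Fin N → ℝ
  r : ℝ
  s : ℝ
  P_symm : P.IsSymm
  Q_symm : Q.IsSymm

/-- The variables of the explicit dual problem. -/
structure DualVar (N L : ℕ) where
  ω : Fin N → ℝ
  B : Fin L → Matrix (Fin N) (Fin N) ℝ
  β : Fin L → Fin N → ℝ
  η : Fin L → ℝ
  lam : Fin N → ℝ
  pi : ℝ

/-- The Lagrange multipliers of the constraints of the lower-level problem. -/
structure Multipliers (N L : ℕ) where
  α : Fin N → ℝ
  B : Fin L → Matrix (Fin N) (Fin N) ℝ
  β : Fin L → Fin N → ℝ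
  η : Fin L → ℝ
  Lam : Matrix (Fin N) (Fin N) ℝ
  lam : Fin N → ℝ
  ν : ℝ
  pi : ℝ
  ρ : Fin N → ℝ

namespace Data

variable {N M L : ℕ}

/-- The sample mean of the data. -/
noncomputable def μ (D : Data N M L) : Fin N → ℝ := sampleMean D.ξ

/-- The sample covariance matrix of the data. -/
noncomputable def cov (D : Data N M L) : Matrix (Fin N) (Fin N) ℝ := sampleCov D.ξ

/-- The objective of the lower-level problem. -/
noncomputable def primalObj (D : Data N M L) (v : PrimalVar N) : ℝ :=
  1 / (2 * D.γ) * (v.x ⬝ᵥ v.x) + matInner (D.κ₂ • D.cov - vecMulVec D.μ D.μ) v.Q + v.r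
    + matInner D.cov v.P - 2 * (D.μ ⬝ᵥ v.p) + D.κ₁ * v.s

/-- The matrix that the `ℓ`-th semidefinite constraint requires to be positive semidefinite. -/
noncomputable def utilityBlock (D : Data N M L) (z : Fin N → ℝ) (v : PrimalVar N) (l : Fin L) :
    Matrix (Fin N ⊕ Unit) (Fin N ⊕ Unit) ℝ :=
  bordered v.Q ((1 / 2 : ℝ) • v.q + (D.a l / 2) • (diagonal z *ᵥ v.x)) (v.r + D.b l)

/-- The feasible set of the lower-level problem. -/
def primalFeasible (D : Data N M L) (z : Fin N → ℝ) : Set (PrimalVar N) :=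
  {v | v.p = -((1 / 2 : ℝ) • v.q) - v.Q *ᵥ D.μ ∧
    (∀ l, (D.utilityBlock z v l).PosSemidef) ∧
    (bordered v.P v.p v.s).PosSemidef ∧
    diagonal z *ᵥ v.x ∈ portfolios N}

/-- The optimal value `f(z)` of the lower-level problem. -/
noncomputable def lowerValue (D : Data N M L) (z : Fin N → ℝ) : ℝ :=
  sInf (D.primalObj '' D.primalFeasible z)

/-- The objective of the explicit dual problem. -/
noncomputable def dualObj (D : Data N M L) (z : Fin N → ℝ) (d : DualVar N L) : ℝ :=
  -(D.γ / 2) * (z ⬝ᵥ (d.ω * d.ω)) - ∑ l, d.η l * D.b l + d.pi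

/-- The feasible set of the explicit dual problem. -/
def dualFeasible (D : Data N M L) : Set (DualVar N L) :=
  {d | (∀ n, ∑ l, D.a l * d.β l n + d.pi ≤ d.ω n) ∧
    ∑ l, d.B l = D.κ₂ • D.cov - vecMulVec D.μ D.μ
      + vecMulVec D.μ (∑ l, d.β l) + vecMulVec (∑ l, d.β l) D.μ ∧
    ∑ l, d.β l = d.lam + D.μ ∧
    1 - ∑ l, d.η l = 0 ∧
    (∀ l, (bordered (d.B l) (d.β l) (d.η l)).PosSemidef) ∧
    (bordered D.cov d.lam D.κ₁).PosSemidef}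

/-- The Lagrange function of the lower-level problem. -/
noncomputable def lagrangian (D : Data N M L) (z : Fin N → ℝ) (v : PrimalVar N)
    (m : Multipliers N L) : ℝ :=
  D.primalObj v
    - m.α ⬝ᵥ (v.p + (1 / 2 : ℝ) • v.q + v.Q *ᵥ D.μ)
    - ∑ l, matInner (bordered (m.B l) (m.β l) (m.η l)) (D.utilityBlock z v l)
    - matInner (bordered m.Lam m.lam m.ν) (bordered v.P v.p v.s)
    - m.pi * (∑ n, (diagonal z *ᵥ v.x) n - 1)
    - m.ρ ⬝ᵥ (diagonal z *ᵥ v.x)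

/-- The Lagrange dual function: the infimum of the Lagrange function over all (unconstrained)
primal variables, equal to `⊥` where the Lagrange function is unbounded below. -/
noncomputable def lagrangeDual (D : Data N M L) (z : Fin N → ℝ) (m : Multipliers N L) : EReal :=
  ⨅ v : PrimalVar N, (D.lagrangian z v m : EReal)

/-- The point of the explicit dual problem given by Lagrange multipliers: `α`, `Λ`, `ν` are
dropped, and `ρ` is traded for `ω = ∑ a β + π 1 + ρ`. -/
def toDualVar (D : Data N M L) (m : Multipliers N L) : DualVar N L where
  ω := fun n => ∑ l, D.a l * m.β l n + m.pi + m.ρ n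
  B := m.B
  β := m.β
  η := m.η
  lam := m.lam
  pi := m.pi

end Data

/-- The admissible Lagrange multipliers: those of semidefinite constraints are positive
semidefinite, those of inequalities nonnegative, those of equations arbitrary. -/
def admissible (N L : ℕ) : Set (Multipliers N L) :=
  {m | (∀ l, (bordered (m.B l) (m.β l) (m.η l)).PosSemidef) ∧
    (bordered m.Lam m.lam m.ν).PosSemidef ∧ ∀ n, 0 ≤ m.ρ n}

end DRPortfolio

/-!
Collecting the Lagrange function by primal variable (`lagrangian_eq`) shows that it is affine in
`P`, `Q`, `p`, `q`, `r`, `s` and a separable strictly convex quadratic in `x`. It is bounded below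
exactly where the affine coefficients vanish (`stationary_of_forall_le`), which forces
`Λ = Σ`, `ν = κ₁`, `α = -2 ∑ β` and the equations of the explicit dual; the minimum over `x` then
gives the dual objective (`Stationary.lagrangeDual_eq`, where `z ∘ z = z` is used). So `α`, `Λ`, `ν`
are determined by the other multipliers and `ρ` by `ω`, which is the bijection; weak duality follows
from the self-duality of the semidefinite cone.

The explicit dual has a solution by compactness (`exists_isMaxOn_dualObj`). The block with `Σ` and
`κ₁` bounds `λ`, hence `∑ β` and the diagonal of `∑ B`, hence all entries of the multiplier blocks;
taking `ω` as small as possible, a lower bound on the objective bounds `π`, because the quadratic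
penalty acts on at least one selected asset.

For a primal solution, the explicit dual is viewed as a concave problem with linear constraints, and
the primal variables are the multipliers of those constraints. The dual is strictly feasible:
splitting the positive definite second moment matrix with blocks `κ₂ Σ + μ μᵀ`, `μ`, `1` evenly
gives interior points of the semidefinite cones, around which the constraint values cover a neighbourhood
(`exists_smul_mem_coeffSet`). The Riesz extension theorem (`exists_multiplier`) then gives a primal
point at which the Lagrange function is at most the dual optimum for all admissible multipliers
(`exists_forall_lagrangian_le`). Since the multipliers form a cone, that point is feasible and its
objective is at most the dual optimum (`mem_primalFeasible_of_forall_lagrangian_le`). No constraint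
qualification is needed on the primal side, where `Z x ≥ 0` is never strict on unselected assets.
-/

namespace DRPortfolio

/-! ### Multipliers from the Riesz extension theorem -/

/-- A Lagrange multiplier theorem without topology. `S` collects the pairs of a constraint value and
an upper bound for a nonnegative gap; if the constraint values cover a neighbourhood of `0` in the
algebraic sense, some linear functional keeps the gap nonnegative off the constraint as well. This
is the Riesz extension of the second coordinate from `{0} × ℝ`, positive on the cone over `S`. -/
theorem exists_multiplier {W : Type*} [AddCommGroup W] [Module ℝ W] {S : Set (W × ℝ)}
    (hS : Convex ℝ S) (h0 : ∀ t, ((0 : W), t) ∈ S → 0 ≤ t)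
    (hcore : ∀ w : W, ∃ ε : ℝ, 0 < ε ∧ ∃ t, (ε • w, t) ∈ S) :
    ∃ v : W →ₗ[ℝ] ℝ, ∀ w t, (w, t) ∈ S → 0 ≤ t + v w := by
  obtain ⟨ε₀, hε₀, t₀, ht₀⟩ := hcore 0
  -- The cone generated by `S`, with the origin added.
  let K : PointedCone ℝ (W × ℝ) :=
    { carrier := {p | p = 0 ∨ ∃ c : ℝ, 0 < c ∧ ∃ y ∈ S, p = c • y}
      zero_mem' := Or.inl rfl
      add_mem' := by
        rintro p q (rfl | ⟨c, hc, y, hy, rfl⟩) hq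
        · simpa using hq
        · rcases hq with rfl | ⟨d, hd, y', hy', rfl⟩
          · exact Or.inr ⟨c, hc, y, hy, by simp⟩
          · have hcd : 0 < c + d := add_pos hc hd
            refine Or.inr ⟨c + d, hcd, (c / (c + d)) • y + (d / (c + d)) • y',
              hS hy hy' (by positivity) (by positivity) (by field_simp), ?_⟩
            rw [smul_add, smul_smul, smul_smul, mul_div_cancel₀ _ hcd.ne',
              mul_div_cancel₀ _ hcd.ne']
      smul_mem' := by
        rintro ⟨c, hc⟩ p (rfl | ⟨d, hd, y, hy, rfl⟩)
        · left; simp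
        · rcases hc.eq_or_lt with rfl | hc
          · left; ext <;> simp
          · exact Or.inr ⟨c * d, mul_pos hc hd, y, hy, by
              rw [mul_smul]; rfl⟩ }
  let f : W × ℝ →ₗ.[ℝ] ℝ := ⟨LinearMap.ker (LinearMap.fst ℝ W ℝ),
    (LinearMap.snd ℝ W ℝ).domRestrict _⟩
  obtain ⟨g, hgf, hgK⟩ := riesz_extension K f (by
      rintro ⟨⟨w, t⟩, hw⟩ hx
      obtain rfl : w = 0 := hw
      change 0 ≤ t
      rcases hx with hx | ⟨c, hc, ⟨w, t'⟩, hy, hx⟩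
      · simp_all
      · obtain ⟨h1, rfl⟩ : 0 = c • w ∧ t = c * t' := by simpa using hx
        obtain rfl : w = 0 := by simpa [hc.ne'] using h1.symm
        exact mul_nonneg hc.le (h0 _ hy)) (by
      rintro ⟨w, u⟩
      obtain ⟨ε, hε, t, ht⟩ := hcore w
      refine ⟨⟨(0, ε⁻¹ * t - u), by simp [f]⟩, Or.inr ⟨ε⁻¹, by positivity, _, ht, ?_⟩⟩
      ext <;> simp [hε.ne'])
  refine ⟨g.comp (LinearMap.inl ℝ W ℝ), fun w t hwt => ?_⟩
  have h1 := hgK (w, t) (Or.inr ⟨1, one_pos, _, hwt, by simp⟩)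
  have h2 : g (0, t) = t := hgf ⟨(0, t), by simp [f]⟩
  have h3 : g (w, t) = g (w, 0) + g (0, t) := by rw [← map_add]; simp
  simp only [LinearMap.comp_apply, LinearMap.inl_apply]
  linarith

/-! ### The inner product of matrices and the semidefinite cone -/

section Matrices

variable {ι : Type} [Fintype ι]

/-- The semidefinite cone is self-dual: `A • B` is the sum of the entries of the Hadamard product,
which is positive semidefinite. -/
theorem matInner_nonneg {A B : Matrix ι ι ℝ} (hA : A.PosSemidef) (hB : B.PosSemidef) :
    0 ≤ matInner A B := by
  have h := (hA.hadamard hB).dotProduct_mulVec_nonneg (fun _ => 1)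
  simpa [matInner, dotProduct, mulVec] using h

/-- A positive definite matrix is an interior point of the semidefinite cone. -/
theorem exists_posSemidef_add_smul {A H : Matrix ι ι ℝ} (hA : A.PosDef) (hH : H.IsHermitian) :
    ∃ ε : ℝ, 0 < ε ∧ ∀ δ, 0 ≤ δ → δ ≤ ε → (A + δ • H).PosSemidef := by
  have hc : ∀ M : Matrix ι ι ℝ, Continuous fun x : ι → ℝ => x ⬝ᵥ M *ᵥ x := fun M => by
    unfold dotProduct mulVec dotProduct; fun_prop
  have hpos : ∀ x : ι → ℝ, x ≠ 0 → 0 < x ⬝ᵥ A *ᵥ x := fun x hx => by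
    simpa using hA.dotProduct_mulVec_pos hx
  obtain ⟨C, hC⟩ := (isCompact_sphere (0 : ι → ℝ) 1).bddBelow_image
    (f := fun x => (x ⬝ᵥ H *ᵥ x) / (x ⬝ᵥ A *ᵥ x))
    ((hc H).continuousOn.div (hc A).continuousOn fun x hx =>
      (hpos x (ne_zero_of_mem_unit_sphere ⟨x, hx⟩)).ne')
  refine ⟨(|C| + 1)⁻¹, by positivity, fun δ hδ hδC => ?_⟩
  refine PosSemidef.of_dotProduct_mulVec_nonneg
    (hA.isHermitian.add (hH.smul (IsSelfAdjoint.all δ))) fun x => ?_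
  simp only [star_trivial, add_mulVec, smul_mulVec, dotProduct_add, dotProduct_smul, smul_eq_mul]
  by_cases hx : x = 0
  · simp [hx]
  have hn : 0 < ‖x‖ := norm_pos_iff.2 hx
  have h1 := hC ⟨‖x‖⁻¹ • x, by simp [norm_smul, hn.ne'], rfl⟩
  simp only [mulVec_smul, dotProduct_smul, smul_dotProduct, smul_eq_mul] at h1
  rw [mul_div_mul_left _ _ (by positivity), mul_div_mul_left _ _ (by positivity),
    le_div_iff₀ (hpos x hx)] at h1
  have h2 : δ * (|C| + 1) ≤ 1 := by
    rwa [← le_div_iff₀ (by positivity), one_div]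
  have h3 : -|C| ≤ C := neg_abs_le C
  have hp := hpos x hx
  nlinarith [mul_le_mul_of_nonneg_right h3 hp.le, mul_le_mul_of_nonneg_left h1 hδ,
    mul_le_mul_of_nonneg_right h2 hp.le, mul_nonneg hδ hp.le]

theorem abs_apply_le {A : Matrix ι ι ℝ} (hA : A.PosSemidef) (i j : ι) :
    |A i j| ≤ (A i i + A j j) / 2 := by
  classical
  have hs : A j i = A i j := by simpa using hA.isHermitian.apply i j
  have key : ∀ c : ℝ, 0 ≤ A i i + 2 * c * A i j + c ^ 2 * A j j := fun c => by
    have h := hA.dotProduct_mulVec_nonneg (Pi.single i 1 + Pi.single j c)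
    simp [mulVec_add, dotProduct_add, add_dotProduct, hs] at h
    linarith
  have h1 := key 1
  have h2 := key (-1)
  rw [abs_le]
  constructor <;> linarith

theorem matInner_add_transpose_left (A B : Matrix ι ι ℝ) :
    matInner (A + Aᵀ) B = matInner A (B + Bᵀ) := by
  have h : matInner Aᵀ B = matInner A Bᵀ := by
    unfold matInner
    rw [Finset.sum_comm]
    rfl
  simp only [matInner, Matrix.add_apply, mul_add, add_mul, Finset.sum_add_distrib] at h ⊢
  rw [h]

theorem eq_zero_of_matInner_self {A : Matrix ι ι ℝ} (h : matInner A A = 0) : A = 0 := by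
  ext i j
  have h1 := (Finset.sum_eq_zero_iff_of_nonneg fun i _ =>
    Finset.sum_nonneg fun j _ => mul_self_nonneg (A i j)).1 h i (Finset.mem_univ i)
  have h2 := (Finset.sum_eq_zero_iff_of_nonneg fun j _ =>
    mul_self_nonneg (A i j)).1 h1 j (Finset.mem_univ j)
  exact mul_self_eq_zero.1 h2

end Matrices

/-! ### Bordered matrices -/

section Bordered

variable {N : ℕ}

theorem bordered_isHermitian_iff {A : Matrix (Fin N) (Fin N) ℝ} {u : Fin N → ℝ} {c : ℝ} :
    (bordered A u c).IsHermitian ↔ A.IsSymm := by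
  constructor
  · intro h
    ext i j
    simpa [bordered] using h.apply (Sum.inl i) (Sum.inl j)
  · intro h
    ext (i | i) (j | j) <;> simp [bordered, h.apply]

theorem dotProduct_bordered_mulVec (A : Matrix (Fin N) (Fin N) ℝ) (u : Fin N → ℝ) (c : ℝ)
    (y : Fin N ⊕ Unit → ℝ) :
    y ⬝ᵥ bordered A u c *ᵥ y = (y ∘ Sum.inl) ⬝ᵥ A *ᵥ (y ∘ Sum.inl)
      + 2 * y (Sum.inr ()) * (u ⬝ᵥ (y ∘ Sum.inl)) + c * y (Sum.inr ()) ^ 2 := by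
  simp only [dotProduct, mulVec, bordered, Fintype.sum_sum_type, fromBlocks_apply₁₁,
    fromBlocks_apply₁₂, fromBlocks_apply₂₁, fromBlocks_apply₂₂, replicateCol_apply,
    replicateRow_apply, of_apply, Finset.univ_unique, Finset.sum_singleton, Function.comp_apply,
    mul_add, Finset.sum_add_distrib, PUnit.default_eq_unit, Finset.mul_sum]
  have : ∑ x, 2 * y (Sum.inr ()) * (u x * y (Sum.inl x))
      = ∑ x, y (Sum.inl x) * (u x * y (Sum.inr ()))
        + ∑ x, y (Sum.inr ()) * (u x * y (Sum.inl x)) := by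
    rw [← Finset.sum_add_distrib]
    exact Finset.sum_congr rfl fun _ _ => by ring
  rw [this]; ring

theorem bordered_posSemidef_iff {A : Matrix (Fin N) (Fin N) ℝ} {u : Fin N → ℝ} {c : ℝ} :
    (bordered A u c).PosSemidef ↔ A.IsSymm ∧
      ∀ (y : Fin N → ℝ) (t : ℝ), 0 ≤ y ⬝ᵥ A *ᵥ y + 2 * t * (u ⬝ᵥ y) + c * t ^ 2 := by
  rw [posSemidef_iff_dotProduct_mulVec, bordered_isHermitian_iff]
  refine and_congr_right fun _ => ⟨fun h y t => ?_, fun h y => ?_⟩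
  · have := h (Sum.elim y fun _ => t)
    rw [star_trivial, dotProduct_bordered_mulVec] at this
    simpa using this
  · rw [star_trivial, dotProduct_bordered_mulVec]
    exact h _ _

theorem bordered_posDef {A : Matrix (Fin N) (Fin N) ℝ} {u : Fin N → ℝ} {c : ℝ} (hA : A.IsSymm)
    (h : ∀ (y : Fin N → ℝ) (t : ℝ), (y ≠ 0 ∨ t ≠ 0) →
      0 < y ⬝ᵥ A *ᵥ y + 2 * t * (u ⬝ᵥ y) + c * t ^ 2) :
    (bordered A u c).PosDef := by
  refine PosDef.of_dotProduct_mulVec_pos (bordered_isHermitian_iff.2 hA) fun y hy => ?_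
  rw [star_trivial, dotProduct_bordered_mulVec]
  refine h _ _ ?_
  by_contra! hc
  refine hy (funext ?_)
  rintro (i | i)
  · exact congrFun hc.1 i
  · exact hc.2

theorem matInner_bordered (A B : Matrix (Fin N) (Fin N) ℝ) (u w : Fin N → ℝ) (c d : ℝ) :
    matInner (bordered A u c) (bordered B w d) = matInner A B + 2 * (u ⬝ᵥ w) + c * d := by
  simp only [matInner, bordered, Fintype.sum_sum_type, fromBlocks_apply₁₁,
    fromBlocks_apply₁₂, fromBlocks_apply₂₁, fromBlocks_apply₂₂, replicateCol_apply,
    replicateRow_apply, of_apply, Finset.univ_unique, Finset.sum_singleton, dotProduct,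
    Finset.sum_add_distrib]
  ring

theorem bordered_add (A B : Matrix (Fin N) (Fin N) ℝ) (u w : Fin N → ℝ) (c d : ℝ) :
    bordered (A + B) (u + w) (c + d) = bordered A u c + bordered B w d := by
  ext (i | i) (j | j) <;> simp [bordered]

theorem bordered_smul (r : ℝ) (A : Matrix (Fin N) (Fin N) ℝ) (u : Fin N → ℝ) (c : ℝ) :
    bordered (r • A) (r • u) (r * c) = r • bordered A u c := by
  ext (i | i) (j | j) <;> simp [bordered]

/-- The matrix is `(y, t) (y, t)ᵀ`. -/
theorem bordered_vecMulVec_posSemidef (y : Fin N → ℝ) (t : ℝ) :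
    (bordered (vecMulVec y y) (t • y) (t ^ 2)).PosSemidef := by
  refine bordered_posSemidef_iff.2 ⟨by ext i j; simp [vecMulVec_apply, mul_comm], fun x s => ?_⟩
  have h : x ⬝ᵥ vecMulVec y y *ᵥ x = (y ⬝ᵥ x) ^ 2 := by
    simp [vecMulVec_mulVec, dotProduct_comm x y, sq]
  rw [h, smul_dotProduct, smul_eq_mul]
  nlinarith [sq_nonneg (y ⬝ᵥ x + s * t)]

theorem bordered_zero : bordered (0 : Matrix (Fin N) (Fin N) ℝ) 0 0 = 0 := by
  ext (i | i) (j | j) <;> simp [bordered]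

theorem matInner_vecMulVec (y w : Fin N → ℝ) (A : Matrix (Fin N) (Fin N) ℝ) :
    matInner (vecMulVec y w) A = y ⬝ᵥ A *ᵥ w := by
  simp only [matInner, vecMulVec_apply, dotProduct, mulVec, Finset.mul_sum]
  exact Finset.sum_congr rfl fun i _ => Finset.sum_congr rfl fun j _ => by ring

end Bordered

section MatInner

variable {ι : Type} [Fintype ι]

theorem matInner_add_left (A B C : Matrix ι ι ℝ) :
    matInner (A + B) C = matInner A C + matInner B C := by
  simp only [matInner, Matrix.add_apply, add_mul, Finset.sum_add_distrib]

theorem matInner_sub_left (A B C : Matrix ι ι ℝ) :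
    matInner (A - B) C = matInner A C - matInner B C := by
  simp only [matInner, Matrix.sub_apply, sub_mul, Finset.sum_sub_distrib]

theorem matInner_smul_left (r : ℝ) (A C : Matrix ι ι ℝ) :
    matInner (r • A) C = r * matInner A C := by
  simp only [matInner, Matrix.smul_apply, smul_eq_mul, Finset.mul_sum, mul_assoc]

theorem matInner_smul_right (r : ℝ) (A C : Matrix ι ι ℝ) :
    matInner A (r • C) = r * matInner A C := by
  simp only [matInner, Matrix.smul_apply, smul_eq_mul, Finset.mul_sum, mul_left_comm]

theorem matInner_sum_left {L : ℕ} (A : Fin L → Matrix ι ι ℝ) (C : Matrix ι ι ℝ) :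
    matInner (∑ l, A l) C = ∑ l, matInner (A l) C := by
  simp only [matInner, Matrix.sum_apply, Finset.sum_mul]
  refine Eq.symm (Finset.sum_comm.trans ?_)
  exact Finset.sum_congr rfl fun i _ => Finset.sum_comm

theorem matInner_zero_left (A : Matrix ι ι ℝ) : matInner 0 A = 0 := by simp [matInner]

theorem matInner_zero_right (A : Matrix ι ι ℝ) : matInner A 0 = 0 := by simp [matInner]

theorem matInner_transpose_left (A : Matrix ι ι ℝ) {Q : Matrix ι ι ℝ} (hQ : Q.IsSymm) :
    matInner Aᵀ Q = matInner A Q := by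
  unfold matInner
  rw [Finset.sum_comm]
  exact Finset.sum_congr rfl fun i _ => Finset.sum_congr rfl fun j _ => by
    rw [transpose_apply, hQ.apply]

end MatInner

/-! ### The Lagrange function and its infimum -/

variable {N M L : ℕ}

theorem eq_zero_of_forall_le_add_mul {K c s : ℝ} (h : ∀ t : ℝ, K ≤ c + t * s) : s = 0 := by
  by_contra hs
  have := h ((K - c - 1) / s)
  rw [div_mul_cancel₀ _ hs] at this
  linarith

theorem nonneg_of_forall_sub_mul_le {K c s : ℝ} (h : ∀ t : ℝ, 0 ≤ t → c - t * s ≤ K) : 0 ≤ s := by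
  by_contra! hs
  have h1 := h ((|K - c| + 1) / -s) (div_nonneg (by positivity) (by linarith))
  have h2 : (|K - c| + 1) / -s * s = -(|K - c| + 1) := by
    rw [div_neg, neg_mul, div_mul_cancel₀ _ hs.ne]
  rw [h2] at h1
  linarith [le_abs_self (K - c)]

namespace Data

/-- The Lagrange function with its terms collected by primal variable. -/
theorem lagrangian_eq (D : Data N M L) (z : Fin N → ℝ) (v : PrimalVar N) (m : Multipliers N L) :
    D.lagrangian z v m = 1 / (2 * D.γ) * (v.x ⬝ᵥ v.x) - v.x ⬝ᵥ (z * (D.toDualVar m).ω)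
      + matInner (D.cov - m.Lam) v.P
      + matInner (D.κ₂ • D.cov - vecMulVec D.μ D.μ - vecMulVec m.α D.μ - ∑ l, m.B l) v.Q
      - ((2 : ℝ) • D.μ + m.α + (2 : ℝ) • m.lam) ⬝ᵥ v.p
      - ((1 / 2 : ℝ) • m.α + ∑ l, m.β l) ⬝ᵥ v.q
      + (1 - ∑ l, m.η l) * v.r + (D.κ₁ - m.ν) * v.s - ∑ l, m.η l * D.b l + m.pi := by
  have hx : v.x ⬝ᵥ (z * (D.toDualVar m).ω)
      = ∑ l, D.a l * (m.β l ⬝ᵥ (diagonal z *ᵥ v.x)) + m.pi * ∑ n, (diagonal z *ᵥ v.x) n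
        + m.ρ ⬝ᵥ (diagonal z *ᵥ v.x) := by
    simp only [dotProduct, Pi.mul_apply, toDualVar, mulVec_diagonal, Finset.mul_sum]
    rw [Finset.sum_comm, ← Finset.sum_add_distrib, ← Finset.sum_add_distrib]
    refine Finset.sum_congr rfl fun n _ => ?_
    simp only [mul_add, Finset.mul_sum]
    congr 1
    · congr 1
      · exact Finset.sum_congr rfl fun l _ => by ring
      · ring
    · ring
  have hb : ∑ l, matInner (bordered (m.B l) (m.β l) (m.η l)) (D.utilityBlock z v l)
      = matInner (∑ l, m.B l) v.Q + (∑ l, m.β l) ⬝ᵥ v.q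
        + ∑ l, D.a l * (m.β l ⬝ᵥ (diagonal z *ᵥ v.x))
        + (∑ l, m.η l) * v.r + ∑ l, m.η l * D.b l := by
    rw [matInner_sum_left, sum_dotProduct, Finset.sum_mul]
    simp only [← Finset.sum_add_distrib]
    refine Finset.sum_congr rfl fun l _ => ?_
    rw [utilityBlock, matInner_bordered, dotProduct_add, dotProduct_smul, dotProduct_smul,
      smul_eq_mul, smul_eq_mul]
    ring
  rw [lagrangian, hb, hx, primalObj, matInner_bordered]
  simp only [matInner_sub_left, matInner_vecMulVec, dotProduct_add, add_dotProduct,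
    dotProduct_smul, smul_dotProduct, smul_eq_mul, sub_mul]
  ring

/-- The conditions on the multipliers under which the Lagrange function does not depend on the
primal variables other than `x`. As `α = -2 ∑ β`, the equation for `∑ B` is that the symmetric part
of the coefficient of `Q` vanishes. -/
structure Stationary (D : Data N M L) (m : Multipliers N L) : Prop where
  Lam_eq : m.Lam = D.cov
  ν_eq : m.ν = D.κ₁
  α_eq : m.α = (-2 : ℝ) • ∑ l, m.β l
  β_eq : ∑ l, m.β l = m.lam + D.μ
  η_eq : 1 - ∑ l, m.η l = 0
  B_eq : ∑ l, m.B l = D.κ₂ • D.cov - vecMulVec D.μ D.μ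
      + vecMulVec D.μ (∑ l, m.β l) + vecMulVec (∑ l, m.β l) D.μ

theorem Stationary.lagrangian_eq {D : Data N M L} {m : Multipliers N L} (h : D.Stationary m)
    (z : Fin N → ℝ) (v : PrimalVar N) :
    D.lagrangian z v m = 1 / (2 * D.γ) * (v.x ⬝ᵥ v.x) - v.x ⬝ᵥ (z * (D.toDualVar m).ω)
      - ∑ l, m.η l * D.b l + m.pi := by
  have hp : (2 : ℝ) • D.μ + m.α + (2 : ℝ) • m.lam = 0 := by
    rw [h.α_eq, h.β_eq]; ext n; simp
  have hq : (1 / 2 : ℝ) • m.α + ∑ l, m.β l = 0 := by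
    rw [h.α_eq, smul_smul]; simp
  have hQ : matInner (D.κ₂ • D.cov - vecMulVec D.μ D.μ - vecMulVec m.α D.μ - ∑ l, m.B l) v.Q
      = 0 := by
    have h1 : matInner (vecMulVec (∑ l, m.β l) D.μ) v.Q
        = matInner (vecMulVec D.μ (∑ l, m.β l)) v.Q := by
      rw [← matInner_transpose_left _ v.Q_symm, transpose_vecMulVec]
    rw [h.B_eq, h.α_eq, smul_vecMulVec]
    simp only [matInner_sub_left, matInner_add_left, matInner_smul_left, h1]
    ring
  rw [D.lagrangian_eq, h.Lam_eq, sub_self, matInner_zero_left, hQ, hp, hq, h.η_eq, h.ν_eq]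
  simp

/-- Stationarity from vanishing coefficients of the Lagrange function. Only the symmetric
part of the coefficient `E` of `Q` is required to vanish, as `Q` ranges over symmetric matrices. -/
theorem stationary_of_coeff_eq_zero {D : Data N M L} {m : Multipliers N L} (hcov : D.cov.IsSymm)
    (hB : ∀ l, (m.B l).IsSymm) (hP : D.cov - m.Lam = 0)
    {E : Matrix (Fin N) (Fin N) ℝ}
    (hE : E = D.κ₂ • D.cov - vecMulVec D.μ D.μ - vecMulVec m.α D.μ - ∑ l, m.B l)
    (hQ : E + Eᵀ = 0) (hp : (2 : ℝ) • D.μ + m.α + (2 : ℝ) • m.lam = 0)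
    (hq : (1 / 2 : ℝ) • m.α + ∑ l, m.β l = 0) (hr : 1 - ∑ l, m.η l = 0)
    (hs : D.κ₁ - m.ν = 0) : D.Stationary m := by
  have hα : m.α = (-2 : ℝ) • ∑ l, m.β l := by
    ext n
    have := congrFun hq n
    simp at this ⊢
    linarith
  have hβ : ∑ l, m.β l = m.lam + D.μ := by
    ext n
    have h1 := congrFun hq n
    have h2 := congrFun hp n
    simp at h1 h2 ⊢
    linarith
  refine ⟨(sub_eq_zero.1 hP).symm, (sub_eq_zero.1 hs).symm, hα, hβ, hr, ?_⟩
  have hBs : (∑ l, m.B l)ᵀ = ∑ l, m.B l := by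
    rw [transpose_sum]
    exact Finset.sum_congr rfl fun l _ => hB l
  have hEt : Eᵀ = D.κ₂ • D.cov - vecMulVec D.μ D.μ - vecMulVec D.μ m.α - ∑ l, m.B l := by
    rw [hE, transpose_sub, transpose_sub, transpose_sub, transpose_smul, hcov, hBs,
      transpose_vecMulVec, transpose_vecMulVec]
  rw [hEt, hE, hα, smul_vecMulVec, vecMulVec_smul] at hQ
  ext i j
  have := congrFun (congrFun hQ i) j
  simp at this ⊢
  linarith

/-- Where the Lagrange function is bounded below, its coefficients vanish: it is affine in each
primal variable other than `x`. -/
theorem stationary_of_forall_le {D : Data N M L} {m : Multipliers N L} {z : Fin N → ℝ} {K : ℝ}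
    (hcov : D.cov.IsSymm) (hB : ∀ l, (m.B l).IsSymm) (hLam : m.Lam.IsSymm)
    (h : ∀ v, K ≤ D.lagrangian z v m) : D.Stationary m := by
  simp only [D.lagrangian_eq] at h
  have hP : D.cov - m.Lam = 0 := eq_zero_of_matInner_self <| eq_zero_of_forall_le_add_mul
    (K := K) (c := - ∑ l, m.η l * D.b l + m.pi) fun t => by
      have := h ⟨0, t • (D.cov - m.Lam), 0, 0, 0, 0, 0, (hcov.sub hLam).smul t, by simp⟩
      simp only [matInner_smul_right, matInner_zero_right] at this
      simp at this
      linarith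
  have hp : (2 : ℝ) • D.μ + m.α + (2 : ℝ) • m.lam = 0 := dotProduct_self_eq_zero.1 <|
    eq_zero_of_forall_le_add_mul (K := K) (c := - ∑ l, m.η l * D.b l + m.pi) fun t => by
      have := h ⟨0, 0, 0, (-t) • ((2 : ℝ) • D.μ + m.α + (2 : ℝ) • m.lam), 0, 0, 0, by simp, by simp⟩
      simp only [matInner_zero_right, dotProduct_smul] at this
      simp at this
      simp
      linarith
  have hq : (1 / 2 : ℝ) • m.α + ∑ l, m.β l = 0 := dotProduct_self_eq_zero.1 <|
    eq_zero_of_forall_le_add_mul (K := K) (c := - ∑ l, m.η l * D.b l + m.pi) fun t => by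
      have := h ⟨0, 0, 0, 0, (-t) • ((1 / 2 : ℝ) • m.α + ∑ l, m.β l), 0, 0, by simp, by simp⟩
      simp only [matInner_zero_right, dotProduct_smul] at this
      simp at this
      simp
      linarith
  have hr : 1 - ∑ l, m.η l = 0 :=
    eq_zero_of_forall_le_add_mul (K := K) (c := - ∑ l, m.η l * D.b l + m.pi) fun t => by
      have := h ⟨0, 0, 0, 0, 0, t, 0, by simp, by simp⟩
      simp only [matInner_zero_right] at this
      simp at this
      linarith
  have hs : D.κ₁ - m.ν = 0 :=
    eq_zero_of_forall_le_add_mul (K := K) (c := - ∑ l, m.η l * D.b l + m.pi) fun t => by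
      have := h ⟨0, 0, 0, 0, 0, 0, t, by simp, by simp⟩
      simp only [matInner_zero_right] at this
      simp at this
      linarith
  set E := D.κ₂ • D.cov - vecMulVec D.μ D.μ - vecMulVec m.α D.μ - ∑ l, m.B l with hE
  have hQ : E + Eᵀ = 0 := by
    have hsym : (E + Eᵀ).IsSymm := by
      rw [IsSymm, transpose_add, transpose_transpose, add_comm]
    have h1 : matInner E (E + Eᵀ) = 0 :=
      eq_zero_of_forall_le_add_mul (K := K) (c := - ∑ l, m.η l * D.b l + m.pi) fun t => by
        have := h ⟨0, 0, t • (E + Eᵀ), 0, 0, 0, 0, by simp, hsym.smul t⟩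
        simp only [matInner_smul_right, matInner_zero_right] at this
        simp at this
        linarith
    refine eq_zero_of_matInner_self ?_
    rw [matInner_add_left, matInner_transpose_left _ hsym, h1, add_zero]
  exact stationary_of_coeff_eq_zero hcov hB hP hE hQ hp hq hr hs

/-- The multipliers that `toDualVar` sends to a given point of the explicit dual problem. -/
noncomputable def liftDual (D : Data N M L) (d : DualVar N L) : Multipliers N L where
  α := (-2 : ℝ) • ∑ l, d.β l
  B := d.B
  β := d.β
  η := d.η
  Lam := D.cov
  lam := d.lam
  ν := D.κ₁
  pi := d.pi
  ρ := fun n => d.ω n - (∑ l, D.a l * d.β l n + d.pi)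

theorem toDualVar_liftDual (D : Data N M L) (d : DualVar N L) :
    D.toDualVar (D.liftDual d) = d := by
  cases d
  simp [toDualVar, liftDual]

theorem liftDual_mem_admissible {D : Data N M L} {d : DualVar N L} (hd : d ∈ D.dualFeasible) :
    D.liftDual d ∈ admissible N L :=
  ⟨hd.2.2.2.2.1, hd.2.2.2.2.2, fun n => sub_nonneg.2 (hd.1 n)⟩

theorem stationary_liftDual {D : Data N M L} {d : DualVar N L} (hd : d ∈ D.dualFeasible) :
    D.Stationary (D.liftDual d) :=
  ⟨rfl, rfl, rfl, hd.2.2.1, hd.2.2.2.1, hd.2.1⟩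

theorem Stationary.toDualVar_mem {D : Data N M L} {m : Multipliers N L} (h : D.Stationary m)
    (hm : m ∈ admissible N L) : D.toDualVar m ∈ D.dualFeasible :=
  ⟨fun n => by simp [toDualVar, hm.2.2 n], h.B_eq, h.β_eq, h.η_eq, hm.1, by
    have := hm.2.1
    rwa [h.Lam_eq, h.ν_eq] at this⟩

theorem Stationary.liftDual_toDualVar {D : Data N M L} {m : Multipliers N L}
    (h : D.Stationary m) : D.liftDual (D.toDualVar m) = m := by
  obtain ⟨α, B, β, η, Lam, lam, ν, pi, ρ⟩ := m
  simp only [liftDual, toDualVar, Multipliers.mk.injEq, true_and]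
  exact ⟨h.α_eq.symm, h.Lam_eq.symm, h.ν_eq.symm, by ext n; simp⟩

theorem mul_self_of_mem_selections {k : ℕ} {z : Fin N → ℝ} (hz : z ∈ selections N k) (n : Fin N) :
    z n * z n = z n := by
  rcases hz.1 n with h | h <;> simp [h]

/-- The minimum over `x` is that of a separable quadratic function, attained at
`x = γ z ∘ ω`. -/
theorem Stationary.lagrangeDual_eq {D : Data N M L} {m : Multipliers N L} (h : D.Stationary m)
    (hγ : 0 < D.γ) {k : ℕ} {z : Fin N → ℝ} (hz : z ∈ selections N k) :
    D.lagrangeDual z m = (D.dualObj z (D.toDualVar m) : EReal) := by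
  have hzz := mul_self_of_mem_selections hz
  set ω := (D.toDualVar m).ω with hω
  have key : ∀ v : PrimalVar N, D.lagrangian z v m = D.dualObj z (D.toDualVar m)
      + 1 / (2 * D.γ) * ∑ n, (v.x n - D.γ * (z n * ω n)) ^ 2 := fun v => by
    have : 1 / (2 * D.γ) * ∑ n, (v.x n - D.γ * (z n * ω n)) ^ 2
        = 1 / (2 * D.γ) * (v.x ⬝ᵥ v.x) - v.x ⬝ᵥ (z * ω) + D.γ / 2 * (z ⬝ᵥ (ω * ω)) := by
      simp only [dotProduct, Pi.mul_apply, Finset.mul_sum, ← Finset.sum_sub_distrib,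
        ← Finset.sum_add_distrib]
      refine Finset.sum_congr rfl fun n _ => ?_
      have := hzz n
      field_simp
      linear_combination D.γ ^ 2 * ω n ^ 2 * this
    rw [this, h.lagrangian_eq, dualObj]
    simp only [← hω]
    simp only [toDualVar]
    ring
  refine le_antisymm ?_ (le_iInf fun v => ?_)
  · refine (iInf_le _ ⟨fun n => D.γ * (z n * ω n), 0, 0, 0, 0, 0, 0, by simp, by simp⟩).trans ?_
    rw [key]
    simp
  · rw [key, EReal.coe_le_coe_iff]
    have : 0 ≤ 1 / (2 * D.γ) * ∑ n, (v.x n - D.γ * (z n * ω n)) ^ 2 :=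
      mul_nonneg (by positivity) (Finset.sum_nonneg fun n _ => sq_nonneg _)
    linarith

theorem stationary_of_lagrangeDual_ne_bot {D : Data N M L} {m : Multipliers N L}
    (hcov : D.cov.IsSymm) (hm : m ∈ admissible N L) {z : Fin N → ℝ}
    (h : D.lagrangeDual z m ≠ ⊥) : D.Stationary m := by
  obtain ⟨K, hK⟩ : ∃ K : ℝ, (K : EReal) ≤ D.lagrangeDual z m := by
    by_contra! hc
    exact h ((EReal.eq_bot_iff_forall_lt _).2 hc)
  exact stationary_of_forall_le (z := z) (K := K) hcov
    (fun l => (bordered_posSemidef_iff.1 (hm.1 l)).1) (bordered_posSemidef_iff.1 hm.2.1).1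
    fun v => EReal.coe_le_coe_iff.1 (hK.trans (iInf_le _ v))

/-- Weak duality for the Lagrange function. -/
theorem lagrangian_le_primalObj {D : Data N M L} {z : Fin N → ℝ} {v : PrimalVar N}
    {m : Multipliers N L} (hv : v ∈ D.primalFeasible z) (hm : m ∈ admissible N L) :
    D.lagrangian z v m ≤ D.primalObj v := by
  obtain ⟨hp, hU, hV, hx1, hx0⟩ := hv
  have h1 : v.p + (1 / 2 : ℝ) • v.q + v.Q *ᵥ D.μ = 0 := by rw [hp]; abel
  have h2 : 0 ≤ ∑ l, matInner (bordered (m.B l) (m.β l) (m.η l)) (D.utilityBlock z v l) :=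
    Finset.sum_nonneg fun l _ => matInner_nonneg (hm.1 l) (hU l)
  have h3 := matInner_nonneg hm.2.1 hV
  have h4 : 0 ≤ m.ρ ⬝ᵥ (diagonal z *ᵥ v.x) :=
    Finset.sum_nonneg fun n _ => mul_nonneg (hm.2.2 n) (hx0 n)
  rw [lagrangian, h1, hx1, dotProduct_zero, sub_self]
  linarith

theorem dualObj_le_primalObj {D : Data N M L} (hγ : 0 < D.γ) {k : ℕ} {z : Fin N → ℝ}
    (hz : z ∈ selections N k) {v : PrimalVar N} {d : DualVar N L} (hv : v ∈ D.primalFeasible z)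
    (hd : d ∈ D.dualFeasible) : D.dualObj z d ≤ D.primalObj v := by
  have h := (stationary_liftDual hd).lagrangeDual_eq hγ hz
  rw [toDualVar_liftDual] at h
  rw [← EReal.coe_le_coe_iff, ← h]
  exact (iInf_le _ v).trans
    (EReal.coe_le_coe_iff.2 (lagrangian_le_primalObj hv (liftDual_mem_admissible hd)))

end Data

/-! ### Solutions of the explicit dual -/

theorem isClosed_setOf_posSemidef {ι : Type} [Fintype ι] :
    IsClosed {A : Matrix ι ι ℝ | A.PosSemidef} := by
  simp only [posSemidef_iff_dotProduct_mulVec, Set.ofPred_and, Set.ofPred_forall]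
  refine (isClosed_eq (by fun_prop) continuous_id).inter (isClosed_iInter fun x => ?_)
  refine isClosed_le continuous_const ?_
  fun_prop

theorem continuous_bordered {T : Type*} [TopologicalSpace T] {A : T → Matrix (Fin N) (Fin N) ℝ}
    {u : T → Fin N → ℝ} {c : T → ℝ} (hA : Continuous A) (hu : Continuous u) (hc : Continuous c) :
    Continuous fun y => bordered (A y) (u y) (c y) := by
  refine hA.matrix_fromBlocks ?_ ?_ ?_ <;> refine continuous_matrix fun i j => ?_ <;>
    simp <;> fun_prop

namespace Data

theorem bordered_cov_posDef {D : Data N M L} (hκ₁ : 0 < D.κ₁) (hcov : D.cov.PosDef) :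
    (bordered D.cov 0 D.κ₁).PosDef := by
  refine bordered_posDef hcov.isHermitian fun y t hyt => ?_
  have h1 := hcov.posSemidef.dotProduct_mulVec_nonneg y
  rw [star_trivial] at h1
  rw [zero_dotProduct, mul_zero, add_zero]
  by_cases hy : y = 0
  · have ht : t ≠ 0 := by simpa [hy] using hyt
    have : 0 < D.κ₁ * t ^ 2 := by positivity
    linarith
  · have h2 := hcov.dotProduct_mulVec_pos hy
    rw [star_trivial] at h2
    have : 0 ≤ D.κ₁ * t ^ 2 := by positivity
    linarith

/-- The second moment matrix of a distribution with mean `μ` and covariance `κ₂ Σ`. -/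
theorem bordered_moment_posDef {D : Data N M L} (hκ₂ : 1 ≤ D.κ₂) (hcov : D.cov.PosDef) :
    (bordered (D.κ₂ • D.cov + vecMulVec D.μ D.μ) D.μ 1).PosDef := by
  have hsymm : D.cov.IsSymm := hcov.isHermitian
  refine bordered_posDef ?_ fun y t hyt => ?_
  · rw [IsSymm, transpose_add, transpose_smul, transpose_vecMulVec, hsymm]
  have h : y ⬝ᵥ (D.κ₂ • D.cov + vecMulVec D.μ D.μ) *ᵥ y + 2 * t * (D.μ ⬝ᵥ y) + 1 * t ^ 2
      = D.κ₂ * (y ⬝ᵥ D.cov *ᵥ y) + (D.μ ⬝ᵥ y + t) ^ 2 := by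
    simp only [add_mulVec, smul_mulVec, vecMulVec_mulVec, dotProduct_add, dotProduct_smul,
      smul_eq_mul, dotProduct_comm y D.μ,
      op_smul_eq_smul]
    ring
  rw [h]
  by_cases hy : y = 0
  · have ht : t ≠ 0 := by simpa [hy] using hyt
    have : 0 < t ^ 2 := by positivity
    simpa [hy] using this
  · have h2 := hcov.dotProduct_mulVec_pos hy
    rw [star_trivial] at h2
    have : 0 < D.κ₂ * (y ⬝ᵥ D.cov *ᵥ y) := mul_pos (by linarith) h2
    nlinarith [sq_nonneg (D.μ ⬝ᵥ y + t)]

theorem dualFeasible_nonempty {D : Data N M L} (hL : 1 ≤ L) (hκ₁ : 0 < D.κ₁) (hκ₂ : 1 ≤ D.κ₂)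
    (hcov : D.cov.PosDef) : D.dualFeasible.Nonempty := by
  have hL' : (L : ℝ) ≠ 0 := by positivity
  have hβ : ∑ _l : Fin L, (1 / L : ℝ) • D.μ = D.μ := by
    rw [Finset.sum_const, Finset.card_univ, Fintype.card_fin, ← Nat.cast_smul_eq_nsmul ℝ,
      smul_smul, mul_one_div_cancel hL', one_smul]
  refine ⟨⟨fun n => ∑ l, D.a l * ((1 / L : ℝ) • D.μ) n + 0,
    fun _ => (1 / L : ℝ) • (D.κ₂ • D.cov + vecMulVec D.μ D.μ), fun _ => (1 / L : ℝ) • D.μ,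
    fun _ => (1 / L : ℝ) * 1, 0, 0⟩, fun n => le_rfl, ?_, ?_, ?_, fun l => ?_, ?_⟩
  · simp only [hβ]
    rw [Finset.sum_const, Finset.card_univ, Fintype.card_fin, ← Nat.cast_smul_eq_nsmul ℝ,
      smul_smul, mul_one_div_cancel hL', one_smul]
    abel
  · rw [hβ, zero_add]
  · simp [hL']
  · rw [bordered_smul]
    exact (bordered_moment_posDef hκ₂ hcov).posSemidef.smul (by positivity)
  · exact (bordered_cov_posDef hκ₁ hcov).posSemidef

/-- The coordinates `B`, `β`, `η`, `π` of a dual point. -/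
abbrev DualCoord (N L : ℕ) : Type :=
  (Fin L → Fin N → Fin N → ℝ) × (Fin L → Fin N → ℝ) × (Fin L → ℝ) × ℝ

/-- The dual point with given `B`, `β`, `η`, `π` and with `ω` of least absolute value. -/
noncomputable def ofCoord (D : Data N M L) (y : DualCoord N L) : DualVar N L where
  ω := fun n => max (∑ l, D.a l * y.2.1 l n + y.2.2.2) 0
  B := fun l => of (y.1 l)
  β := y.2.1
  η := y.2.2.1
  lam := ∑ l, y.2.1 l - D.μ
  pi := y.2.2.2

theorem continuous_dualObj_ofCoord (D : Data N M L) (z : Fin N → ℝ) :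
    Continuous fun y => D.dualObj z (D.ofCoord y) := by
  simp only [dualObj, ofCoord, dotProduct, Pi.mul_apply]
  fun_prop

theorem isClosed_ofCoord_mem (D : Data N M L) :
    IsClosed {y | D.ofCoord y ∈ D.dualFeasible} := by
  have hB : Continuous fun y : DualCoord N L => fun l => (of (y.1 l) : Matrix (Fin N) (Fin N) ℝ) :=
    continuous_pi fun l => continuous_matrix fun i j => by simp only [of_apply]; fun_prop
  have h1 : IsClosed {y : DualCoord N L | ∑ l, (of (y.1 l) : Matrix (Fin N) (Fin N) ℝ)
      = D.κ₂ • D.cov - vecMulVec D.μ D.μ + vecMulVec D.μ (∑ l, y.2.1 l)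
        + vecMulVec (∑ l, y.2.1 l) D.μ} := by
    refine isClosed_eq (continuous_finsetSum _ fun l _ => (continuous_apply l).comp hB) ?_
    refine continuous_matrix fun i j => ?_
    simp only [Matrix.add_apply, Matrix.sub_apply, Matrix.smul_apply, vecMulVec_apply,
      Finset.sum_apply]
    fun_prop
  have h2 : IsClosed {y : DualCoord N L | 1 - ∑ l, y.2.2.1 l = 0} :=
    isClosed_eq (by fun_prop) continuous_const
  have h3 : IsClosed (⋂ l, {y : DualCoord N L |
      (bordered (of (y.1 l)) (y.2.1 l) (y.2.2.1 l)).PosSemidef}) :=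
    isClosed_iInter fun l => isClosed_setOf_posSemidef.preimage (continuous_bordered
      ((continuous_apply l).comp hB) (by fun_prop) (by fun_prop))
  have h4 : IsClosed {y : DualCoord N L |
      (bordered D.cov (∑ l, y.2.1 l - D.μ) D.κ₁).PosSemidef} :=
    isClosed_setOf_posSemidef.preimage
      (continuous_bordered continuous_const (by fun_prop) continuous_const)
  convert h1.inter (h2.inter (h3.inter h4)) using 1
  ext y
  simp only [Set.mem_inter_iff, Set.mem_iInter]
  exact ⟨fun h => ⟨h.2.1, h.2.2.2.1, h.2.2.2.2.1, h.2.2.2.2.2⟩,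
    fun h => ⟨fun n => le_max_left _ _, h.1, (sub_add_cancel _ _).symm, h.2.1, h.2.2.1, h.2.2.2⟩⟩

theorem exists_ofCoord {D : Data N M L} {k : ℕ} {z : Fin N → ℝ} (hγ : 0 < D.γ)
    (hz : z ∈ selections N k) {d : DualVar N L} (hd : d ∈ D.dualFeasible) :
    ∃ y, D.ofCoord y ∈ D.dualFeasible ∧ D.dualObj z d ≤ D.dualObj z (D.ofCoord y) := by
  refine ⟨(fun l => d.B l, d.β, d.η, d.pi), ⟨fun n => le_max_left _ _, hd.2.1, ?_, hd.2.2.2.1,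
    hd.2.2.2.2.1, ?_⟩, ?_⟩
  · simp [ofCoord]
  · have : ∑ l, d.β l - D.μ = d.lam := by rw [hd.2.2.1, add_sub_cancel_right]
    simp only [ofCoord, this]
    exact hd.2.2.2.2.2
  · have h : z ⬝ᵥ ((D.ofCoord (fun l => d.B l, d.β, d.η, d.pi)).ω *
        (D.ofCoord (fun l => d.B l, d.β, d.η, d.pi)).ω) ≤ z ⬝ᵥ (d.ω * d.ω) := by
      refine Finset.sum_le_sum fun n _ => mul_le_mul_of_nonneg_left ?_ ?_
      · simp only [ofCoord, Pi.mul_apply]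
        refine mul_self_le_mul_self (le_max_right _ _) ?_ |>.trans (abs_mul_abs_self _).le
        exact max_le ((hd.1 n).trans (le_abs_self _)) (abs_nonneg _)
      · rw [← mul_self_of_mem_selections hz]; exact mul_self_nonneg _
    have h2 := mul_le_mul_of_nonneg_left h (show 0 ≤ D.γ / 2 by positivity)
    simp only [dualObj]
    simp only [ofCoord] at h2 ⊢
    linarith

/-- The entries of the multiplier matrices are bounded over the dual feasible set: `lam` is bounded
by the last semidefinite constraint, which bounds the diagonals of the `B l` through their sum. -/
theorem exists_bound_dualFeasible (D : Data N M L) :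
    ∃ R : ℝ, 0 ≤ R ∧ ∀ d ∈ D.dualFeasible, ∀ l i j, |bordered (d.B l) (d.β l) (d.η l) i j| ≤ R := by
  let c : Fin N ⊕ Unit → ℝ := Sum.elim (fun i => D.κ₂ * D.cov i i - D.μ i * D.μ i
    + 2 * (|D.μ i| * ((D.cov i i + D.κ₁) / 2 + |D.μ i|))) (fun _ => 1)
  have hR : ∀ i, |c i| ≤ ∑ i, |c i| :=
    fun i => Finset.single_le_sum (f := fun i => |c i|) (fun _ _ => abs_nonneg _)
      (Finset.mem_univ i)
  refine ⟨∑ i, |c i|, Finset.sum_nonneg fun _ _ => abs_nonneg _, fun d hd l i j => ?_⟩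
  obtain ⟨-, hB, hβ, hη, hpsd, hlam⟩ := hd
  have hdiag : ∀ i, bordered (d.B l) (d.β l) (d.η l) i i ≤ c i := by
    rintro (i | i)
    · have h1 : d.B l i i ≤ (∑ l, d.B l) i i := by
        rw [Matrix.sum_apply]
        refine Finset.single_le_sum (f := fun l => d.B l i i) (fun l _ => ?_) (Finset.mem_univ l)
        exact (hpsd l).diag_nonneg (i := Sum.inl i)
      have h2 : |d.lam i| ≤ (D.cov i i + D.κ₁) / 2 := abs_apply_le hlam (Sum.inl i) (Sum.inr ())
      have h3 : D.μ i * (d.lam i + D.μ i) ≤ |D.μ i| * ((D.cov i i + D.κ₁) / 2 + |D.μ i|) := by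
        refine (le_abs_self _).trans ?_
        rw [abs_mul]
        refine mul_le_mul_of_nonneg_left ((abs_add_le _ _).trans ?_) (abs_nonneg _)
        linarith
      rw [hB, hβ] at h1
      simp only [Matrix.add_apply, Matrix.sub_apply, Matrix.smul_apply, vecMulVec_apply,
        Pi.add_apply, smul_eq_mul] at h1
      simp only [bordered, fromBlocks_apply₁₁, c, Sum.elim_inl]
      linarith
    · have h1 : d.η l ≤ ∑ l, d.η l :=
        Finset.single_le_sum (fun l _ => (hpsd l).diag_nonneg (i := Sum.inr ())) (Finset.mem_univ l)
      simp only [bordered, fromBlocks_apply₂₂, of_apply, c, Sum.elim_inr]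
      linarith
  have h1 := (hdiag i).trans ((le_abs_self _).trans (hR i))
  have h2 := (hdiag j).trans ((le_abs_self _).trans (hR j))
  have h3 := abs_apply_le (hpsd l) i j
  linarith

/-- A lower bound on the dual objective bounds `π` from both sides: the objective is at most
`π + C` and, as some asset is selected, at most `π + C - γ/2 (π - C)²` when
`C ≤ π`. -/
theorem exists_bound_pi {D : Data N M L} {k : ℕ} {z : Fin N → ℝ} (hγ : 0 < D.γ) (hk : 1 ≤ k)
    (hz : z ∈ selections N k) (v₀ : ℝ) :
    ∃ R : ℝ, ∀ d ∈ D.dualFeasible, v₀ ≤ D.dualObj z d → |d.pi| ≤ R := by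
  obtain ⟨R, hR0, hR⟩ := D.exists_bound_dualFeasible
  obtain ⟨n₀, hn₀⟩ : ∃ n, z n = 1 := by
    by_contra! hc
    have h0 : ∑ n, z n = 0 := Finset.sum_eq_zero fun n _ => (hz.1 n).resolve_right (hc n)
    rw [hz.2] at h0
    have : k = 0 := by exact_mod_cast h0
    omega
  have hz0 : ∀ n, 0 ≤ z n := fun n => by
    rw [← mul_self_of_mem_selections hz]; exact mul_self_nonneg _
  set Kb := R * ∑ l, |D.b l|
  set Ka := R * ∑ l, |D.a l|
  have hKa : 0 ≤ Ka := mul_nonneg hR0 (Finset.sum_nonneg fun _ _ => abs_nonneg _)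
  have hKb : 0 ≤ Kb := mul_nonneg hR0 (Finset.sum_nonneg fun _ _ => abs_nonneg _)
  set K := Ka + Kb + |v₀|
  have hK : 0 ≤ K := by positivity
  refine ⟨K + 1 + 2 / D.γ * (1 + K), fun d hd hv => ?_⟩
  have hb : |∑ l, d.η l * D.b l| ≤ Kb := by
    refine (Finset.abs_sum_le_sum_abs _ _).trans ?_
    simp only [Kb, Finset.mul_sum]
    refine Finset.sum_le_sum fun l _ => ?_
    rw [abs_mul]
    exact mul_le_mul_of_nonneg_right (hR d hd l (Sum.inr ()) (Sum.inr ())) (abs_nonneg _)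
  have ha : |∑ l, D.a l * d.β l n₀| ≤ Ka := by
    refine (Finset.abs_sum_le_sum_abs _ _).trans ?_
    simp only [Ka, Finset.mul_sum]
    refine Finset.sum_le_sum fun l _ => ?_
    rw [abs_mul, mul_comm]
    exact mul_le_mul_of_nonneg_right (hR d hd l (Sum.inl n₀) (Sum.inr ())) (abs_nonneg _)
  have hω : d.ω n₀ ^ 2 ≤ z ⬝ᵥ (d.ω * d.ω) := by
    have := Finset.single_le_sum (f := fun n => z n * (d.ω n * d.ω n))
      (fun n _ => mul_nonneg (hz0 n) (mul_self_nonneg _)) (Finset.mem_univ n₀)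
    simp only [hn₀, one_mul] at this
    rwa [sq]
  have hω2 := hd.1 n₀
  rw [abs_le] at ha hb
  have hv2 : v₀ ≤ -(D.γ / 2) * d.ω n₀ ^ 2 + Kb + d.pi := by
    have := mul_le_mul_of_nonneg_left hω (show 0 ≤ D.γ / 2 by positivity)
    rw [dualObj] at hv
    linarith
  have hv0 : -|v₀| ≤ v₀ := neg_abs_le _
  have hg : 0 ≤ 2 / D.γ * (1 + K) := by positivity
  rw [abs_le]
  constructor
  · have : 0 ≤ D.γ / 2 * d.ω n₀ ^ 2 := by positivity
    linarith [show K = Ka + Kb + |v₀| from rfl]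
  · by_contra! hc
    -- With `x = π - Ka`, the bound reads `γ/2 x² ≤ x + K`, which fails for `x` this large.
    set x := d.pi - Ka with hx
    have hx1 : 1 + 2 / D.γ * (1 + K) < x := by
      linarith [show K = Ka + Kb + |v₀| from rfl, abs_nonneg v₀]
    have hxω : x ≤ d.ω n₀ := by linarith
    have hx2 : x ^ 2 ≤ d.ω n₀ ^ 2 := pow_le_pow_left₀ (by linarith) hxω 2
    have hx3 : D.γ / 2 * x ^ 2 ≤ x + K := by
      have := mul_le_mul_of_nonneg_left hx2 (show 0 ≤ D.γ / 2 by positivity)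
      linarith [show K = Ka + Kb + |v₀| from rfl]
    have hx4 : 1 + K < D.γ / 2 * x := by
      have : D.γ / 2 * (2 / D.γ * (1 + K)) = 1 + K := by field_simp
      nlinarith
    nlinarith

/-- The explicit dual problem has a solution. -/
theorem exists_isMaxOn_dualObj {D : Data N M L} {k : ℕ} {z : Fin N → ℝ} (hL : 1 ≤ L) (hk : 1 ≤ k)
    (hγ : 0 < D.γ) (hκ₁ : 0 < D.κ₁) (hκ₂ : 1 ≤ D.κ₂) (hcov : D.cov.PosDef)
    (hz : z ∈ selections N k) :
    ∃ d ∈ D.dualFeasible, IsMaxOn (D.dualObj z) D.dualFeasible d := by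
  obtain ⟨d₀, hd₀⟩ := dualFeasible_nonempty hL hκ₁ hκ₂ hcov
  obtain ⟨R, -, hR⟩ := D.exists_bound_dualFeasible
  obtain ⟨R', hR'⟩ := exists_bound_pi (D := D) hγ hk hz (D.dualObj z d₀)
  let G : Set (DualCoord N L) :=
    {y | D.ofCoord y ∈ D.dualFeasible} ∩ {y | D.dualObj z d₀ ≤ D.dualObj z (D.ofCoord y)}
  have hG : IsCompact G := by
    refine (isCompact_Icc
      (a := ((fun _ _ _ => -R, fun _ _ => -R, fun _ => -R, -R') : DualCoord N L))
      (b := (fun _ _ _ => R, fun _ _ => R, fun _ => R, R'))).of_isClosed_subset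
      ((isClosed_ofCoord_mem D).inter
        (isClosed_le continuous_const (continuous_dualObj_ofCoord D z))) ?_
    rintro y ⟨hy, hv⟩
    have h1 := fun l i j => abs_le.1 (hR _ hy l i j)
    have h2 := abs_le.1 (hR' _ hy hv)
    exact ⟨⟨fun l i j => (h1 l (Sum.inl i) (Sum.inl j)).1,
        fun l i => (h1 l (Sum.inl i) (Sum.inr ())).1,
        fun l => (h1 l (Sum.inr ()) (Sum.inr ())).1, h2.1⟩,
      ⟨fun l i j => (h1 l (Sum.inl i) (Sum.inl j)).2,
        fun l i => (h1 l (Sum.inl i) (Sum.inr ())).2,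
        fun l => (h1 l (Sum.inr ()) (Sum.inr ())).2, h2.2⟩⟩
  obtain ⟨y₀, hy₀, hle₀⟩ := exists_ofCoord hγ hz hd₀
  obtain ⟨y, hy, hmax⟩ := hG.exists_isMaxOn ⟨y₀, hy₀, hle₀⟩
    (continuous_dualObj_ofCoord D z).continuousOn
  refine ⟨D.ofCoord y, hy.1, fun d hd => ?_⟩
  obtain ⟨y', hy', hle'⟩ := exists_ofCoord hγ hz hd
  rcases le_total (D.dualObj z d₀) (D.dualObj z (D.ofCoord y')) with h | h
  · exact hle'.trans (hmax ⟨hy', h⟩)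
  · exact (hle'.trans h).trans hy.2

end Data

/-! ### A saddle point of the Lagrange function -/

/-- The space of the coefficients of `x`, `P`, `Q`, `p`, `q`, `r`, `s` in the Lagrange function. -/
abbrev CoeffSpace (N : ℕ) : Type :=
  (Fin N → ℝ) × Matrix (Fin N) (Fin N) ℝ × Matrix (Fin N) (Fin N) ℝ × (Fin N → ℝ) × (Fin N → ℝ)
    × ℝ × ℝ

theorem exists_dotProduct_eq (f : (Fin N → ℝ) →ₗ[ℝ] ℝ) : ∃ x, ∀ w, f w = w ⬝ᵥ x :=
  ⟨fun n => f (Pi.single n 1), fun w => by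
    conv_lhs => rw [← Finset.univ_sum_single w, map_sum]
    refine Finset.sum_congr rfl fun n _ => ?_
    rw [← smul_eq_mul, ← map_smul, ← Pi.single_smul, smul_eq_mul, mul_one]⟩

theorem exists_matInner_eq (f : Matrix (Fin N) (Fin N) ℝ →ₗ[ℝ] ℝ) :
    ∃ V, ∀ A, f A = matInner A V :=
  ⟨of fun i j => f (single i j 1), fun A => by
    conv_lhs => rw [matrix_eq_sum_single A, map_sum]
    refine Finset.sum_congr rfl fun i _ => ?_
    rw [map_sum]
    refine Finset.sum_congr rfl fun j _ => ?_
    rw [of_apply, ← smul_eq_mul, ← map_smul, smul_single, smul_eq_mul, mul_one]⟩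

theorem exists_coeffSpace_functional_eq (f : CoeffSpace N →ₗ[ℝ] ℝ) :
    ∃ (x : Fin N → ℝ) (V U : Matrix (Fin N) (Fin N) ℝ) (p q : Fin N → ℝ) (r s : ℝ),
      ∀ w : CoeffSpace N, f w = w.1 ⬝ᵥ x + matInner w.2.1 V + matInner w.2.2.1 U + w.2.2.2.1 ⬝ᵥ p
        + w.2.2.2.2.1 ⬝ᵥ q + w.2.2.2.2.2.1 * r + w.2.2.2.2.2.2 * s := by
  let f₁ := f.comp (LinearMap.inr ℝ _ _)
  let f₂ := f₁.comp (LinearMap.inr ℝ _ _)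
  let f₃ := f₂.comp (LinearMap.inr ℝ _ _)
  let f₄ := f₃.comp (LinearMap.inr ℝ _ _)
  let f₅ := f₄.comp (LinearMap.inr ℝ _ _)
  obtain ⟨x, hx⟩ := exists_dotProduct_eq (f.comp (LinearMap.inl ℝ _ _))
  obtain ⟨V, hV⟩ := exists_matInner_eq (f₁.comp (LinearMap.inl ℝ _ _))
  obtain ⟨U, hU⟩ := exists_matInner_eq (f₂.comp (LinearMap.inl ℝ _ _))
  obtain ⟨p, hp⟩ := exists_dotProduct_eq (f₃.comp (LinearMap.inl ℝ _ _))
  obtain ⟨q, hq⟩ := exists_dotProduct_eq (f₄.comp (LinearMap.inl ℝ _ _))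
  refine ⟨x, V, U, p, q, f₅ (1, 0), f₅ (0, 1), ?_⟩
  rintro ⟨wx, wP, wQ, wp, wq, wr, ws⟩
  have hr : f₅ (wr, 0) = wr * f₅ (1, 0) := by
    rw [← smul_eq_mul, ← map_smul]; simp
  have hs : f₅ (0, ws) = ws * f₅ (0, 1) := by
    rw [← smul_eq_mul, ← map_smul]; simp
  rw [← hx, ← hV, ← hU, ← hp, ← hq, ← hr, ← hs]
  simp only [f₁, f₂, f₃, f₄, f₅, LinearMap.comp_apply, LinearMap.inl_apply, LinearMap.inr_apply,
    ← map_add]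
  simp

namespace Data

/-- The pairs of a coefficient vector of the Lagrange function (with the opposite sign, and up to
antisymmetric parts of the coefficients of `P` and `Q`) and an upper bound of `val` minus its
constant term. The quadratic term `1/(2γ) x ⬝ x` is replaced by its conjugate `γ/2 u ⬝ u`, with `u`
subtracted from the coefficient of `x`, so that all constraints become linear. -/
def coeffSet (D : Data N M L) (z : Fin N → ℝ) (val : ℝ) : Set (CoeffSpace N × ℝ) :=
  {y | ∃ m ∈ admissible N L, ∃ u : Fin N → ℝ,
    y.1.1 = z * (D.toDualVar m).ω - u ∧
    y.1.2.1 + y.1.2.1ᵀ = (2 : ℝ) • (m.Lam - D.cov) ∧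
    y.1.2.2.1 + y.1.2.2.1ᵀ = (∑ l, m.B l + vecMulVec m.α D.μ)
      + (∑ l, m.B l + vecMulVec m.α D.μ)ᵀ
      - (2 : ℝ) • (D.κ₂ • D.cov - vecMulVec D.μ D.μ) ∧
    y.1.2.2.2.1 = (2 : ℝ) • D.μ + m.α + (2 : ℝ) • m.lam ∧
    y.1.2.2.2.2.1 = (1 / 2 : ℝ) • m.α + ∑ l, m.β l ∧
    y.1.2.2.2.2.2.1 = ∑ l, m.η l - 1 ∧
    y.1.2.2.2.2.2.2 = m.ν - D.κ₁ ∧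
    val + D.γ / 2 * (u ⬝ᵥ u) + ∑ l, m.η l * D.b l - m.pi ≤ y.2}

theorem dotProduct_self_convex {a b : ℝ} (ha : 0 ≤ a) (hb : 0 ≤ b) (hab : a + b = 1)
    (u w : Fin N → ℝ) :
    (a • u + b • w) ⬝ᵥ (a • u + b • w) ≤ a * (u ⬝ᵥ u) + b * (w ⬝ᵥ w) := by
  simp only [dotProduct, Finset.mul_sum, ← Finset.sum_add_distrib]
  refine Finset.sum_le_sum fun n _ => ?_
  simp only [Pi.add_apply, Pi.smul_apply, smul_eq_mul]
  obtain rfl : b = 1 - a := by linarith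
  nlinarith [mul_nonneg (mul_nonneg ha hb) (sq_nonneg (u n - w n))]

theorem convex_coeffSet {D : Data N M L} (hγ : 0 < D.γ) (z : Fin N → ℝ) (val : ℝ) :
    Convex ℝ (D.coeffSet z val) := by
  rintro ⟨⟨x, V, U, p, q, r, s⟩, t⟩ ⟨m, hm, u, hx, hV, hU, hp, hq, hr, hs, ht⟩
    ⟨⟨x', V', U', p', q', r', s'⟩, t'⟩ ⟨m', hm', u', hx', hV', hU', hp', hq', hr', hs', ht'⟩
    c c' hc hc' hcc
  dsimp only at hx hV hU hp hq hr hs ht hx' hV' hU' hp' hq' hr' hs' ht'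
  refine ⟨⟨c • m.α + c' • m'.α, fun l => c • m.B l + c' • m'.B l, fun l => c • m.β l + c' • m'.β l,
    fun l => c * m.η l + c' * m'.η l, c • m.Lam + c' • m'.Lam, c • m.lam + c' • m'.lam,
    c * m.ν + c' * m'.ν, c * m.pi + c' * m'.pi, c • m.ρ + c' • m'.ρ⟩,
    ⟨fun l => ?_, ?_, fun n => ?_⟩,
    c • u + c' • u', ?_, ?_, ?_, ?_, ?_, ?_, ?_, ?_⟩
  · rw [bordered_add, bordered_smul, bordered_smul]
    exact ((hm.1 l).smul hc).add ((hm'.1 l).smul hc')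
  · rw [bordered_add, bordered_smul, bordered_smul]
    exact (hm.2.1.smul hc).add (hm'.2.1.smul hc')
  · exact add_nonneg (mul_nonneg hc (hm.2.2 n)) (mul_nonneg hc' (hm'.2.2 n))
  · change c • x + c' • x' = _
    rw [hx, hx']
    ext n
    simp only [toDualVar, Pi.add_apply, Pi.sub_apply, Pi.mul_apply, Pi.smul_apply, smul_eq_mul]
    have : ∑ l, D.a l * (c * m.β l n + c' * m'.β l n)
        = c * ∑ l, D.a l * m.β l n + c' * ∑ l, D.a l * m'.β l n := by
      rw [Finset.mul_sum, Finset.mul_sum, ← Finset.sum_add_distrib]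
      exact Finset.sum_congr rfl fun l _ => by ring
    rw [this]; ring
  · change (c • V + c' • V') + (c • V + c' • V')ᵀ = _
    calc _ = c • (V + Vᵀ) + c' • (V' + V'ᵀ) := by
          simp only [transpose_add, transpose_smul]; module
      _ = _ := by
          rw [hV, hV']
          obtain rfl : c' = 1 - c := by linarith
          module
  · change (c • U + c' • U') + (c • U + c' • U')ᵀ = _
    calc _ = c • (U + Uᵀ) + c' • (U' + U'ᵀ) := by
          simp only [transpose_add, transpose_smul]; module
      _ = _ := by
          rw [hU, hU']
          obtain rfl : c' = 1 - c := by linarith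
          simp only [Finset.sum_add_distrib, ← Finset.smul_sum, add_vecMulVec, smul_vecMulVec,
            transpose_add, transpose_smul]
          module
  · change c • p + c' • p' = _
    rw [hp, hp']
    obtain rfl : c' = 1 - c := by linarith
    module
  · change c • q + c' • q' = _
    rw [hq, hq']
    simp only [Finset.sum_add_distrib, ← Finset.smul_sum]
    module
  · change c * r + c' * r' = _
    rw [hr, hr']
    simp only [Finset.sum_add_distrib, ← Finset.mul_sum]
    linear_combination -hcc
  · change c * s + c' * s' = _
    rw [hs, hs']
    linear_combination -D.κ₁ * hcc
  · change _ ≤ c * t + c' * t'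
    have h1 := dotProduct_self_convex hc hc' hcc u u'
    have h2 := mul_le_mul_of_nonneg_left h1 (show 0 ≤ D.γ / 2 by positivity)
    have h3 := add_le_add (mul_le_mul_of_nonneg_left ht hc) (mul_le_mul_of_nonneg_left ht' hc')
    have h4 : ∑ l, (c * m.η l + c' * m'.η l) * D.b l
        = c * ∑ l, m.η l * D.b l + c' * ∑ l, m'.η l * D.b l := by
      rw [Finset.mul_sum, Finset.mul_sum, ← Finset.sum_add_distrib]
      exact Finset.sum_congr rfl fun l _ => by ring
    have h5 : val = c * val + c' * val := by rw [← add_mul, hcc, one_mul]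
    dsimp only
    rw [h4]
    linarith

/-- Zero coefficients come from dual feasible points, whose objective is at most `val`. -/
theorem nonneg_of_zero_mem_coeffSet {D : Data N M L} (hcov : D.cov.IsSymm) {k : ℕ} {z : Fin N → ℝ}
    (hz : z ∈ selections N k) {val : ℝ} (hval : ∀ d ∈ D.dualFeasible, D.dualObj z d ≤ val) {t : ℝ}
    (h : ((0 : CoeffSpace N), t) ∈ D.coeffSet z val) : 0 ≤ t := by
  obtain ⟨m, hm, u, hx, hV, hU, hp, hq, hr, hs, ht⟩ := h
  simp only [Prod.fst_zero, Prod.snd_zero, transpose_zero, add_zero] at hx hV hU hp hq hr hs ht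
  have hB : ∀ l, (m.B l).IsSymm := fun l => (bordered_posSemidef_iff.1 (hm.1 l)).1
  have hV' : D.cov - m.Lam = 0 := by
    have := (smul_eq_zero.1 hV.symm).resolve_left two_ne_zero
    rw [← neg_sub, this, neg_zero]
  have hst : D.Stationary m := by
    refine stationary_of_coeff_eq_zero hcov hB hV' rfl ?_ hp.symm hq.symm (by linarith)
      (by linarith)
    have hcovT : D.covᵀ = D.cov := hcov
    refine neg_injective ((Eq.trans ?_ hU.symm).trans neg_zero.symm)
    simp only [transpose_add, transpose_sub, transpose_smul, transpose_vecMulVec D.μ D.μ, hcovT]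
    module
  have hle := hval _ (hst.toDualVar_mem hm)
  have hu : u = z * (D.toDualVar m).ω := (sub_eq_zero.1 hx.symm).symm
  have huu : u ⬝ᵥ u = z ⬝ᵥ ((D.toDualVar m).ω * (D.toDualVar m).ω) := by
    rw [hu]
    refine Finset.sum_congr rfl fun n _ => ?_
    simp only [Pi.mul_apply]
    linear_combination (D.toDualVar m).ω n ^ 2 * mul_self_of_mem_selections hz n
  rw [huu] at ht
  simp only [dualObj] at hle
  simp only [toDualVar] at hle ht
  linarith

/-- Every direction is reached from the strictly feasible multipliers that split the second moment
matrix of a distribution with mean `μ` and covariance `κ₂ Σ` evenly among the blocks. -/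
theorem exists_smul_mem_coeffSet {D : Data N M L} (hL : 1 ≤ L) (hκ₁ : 0 < D.κ₁) (hκ₂ : 1 ≤ D.κ₂)
    (hcov : D.cov.PosDef) (z : Fin N → ℝ) (val : ℝ) (w : CoeffSpace N) :
    ∃ ε : ℝ, 0 < ε ∧ ∃ t, (ε • w, t) ∈ D.coeffSet z val := by
  obtain ⟨x, V, U, p, q, r, s⟩ := w
  have hL' : (L : ℝ) ≠ 0 := by positivity
  have hcovs : D.covᵀ = D.cov := hcov.isHermitian
  set G := U - vecMulVec p D.μ with hG
  obtain ⟨ε₁, hε₁, h₁⟩ := exists_posSemidef_add_smul (bordered_moment_posDef hκ₂ hcov)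
    (H := bordered ((1 / 2 : ℝ) • (G + Gᵀ)) (q - (1 / 2 : ℝ) • p) r)
    (bordered_isHermitian_iff.2 (by
      rw [IsSymm, transpose_smul, transpose_add, transpose_transpose, add_comm]))
  obtain ⟨ε₂, hε₂, h₂⟩ := exists_posSemidef_add_smul (bordered_cov_posDef hκ₁ hcov)
    (H := bordered ((1 / 2 : ℝ) • (V + Vᵀ)) 0 s)
    (bordered_isHermitian_iff.2 (by
      rw [IsSymm, transpose_smul, transpose_add, transpose_transpose, add_comm]))
  set ε := min ε₁ ε₂
  have hε : 0 < ε := lt_min hε₁ hε₂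
  have h₁ := h₁ ε hε.le (min_le_left _ _)
  have h₂ := h₂ ε hε.le (min_le_right _ _)
  rw [← bordered_smul, ← bordered_add] at h₁ h₂
  have havg : ∀ {E : Type} [AddCommGroup E] [Module ℝ E] (y : E),
      ∑ _l : Fin L, (1 / L : ℝ) • y = y := fun y => by
    rw [Finset.sum_const, Finset.card_univ, Fintype.card_fin, ← Nat.cast_smul_eq_nsmul ℝ,
      smul_smul, mul_one_div_cancel hL', one_smul]
  let m : Multipliers N L :=
    { α := (-2 : ℝ) • D.μ + ε • p
      B := fun _ => (1 / L : ℝ) • (D.κ₂ • D.cov + vecMulVec D.μ D.μ + ε • (1 / 2 : ℝ) • (G + Gᵀ))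
      β := fun _ => (1 / L : ℝ) • (D.μ + ε • (q - (1 / 2 : ℝ) • p))
      η := fun _ => (1 / L : ℝ) • (1 + ε * r)
      Lam := D.cov + ε • (1 / 2 : ℝ) • (V + Vᵀ)
      lam := 0
      ν := D.κ₁ + ε * s
      pi := 0
      ρ := 0 }
  refine ⟨ε, hε, _, m, ⟨fun l => ?_, ?_, fun n => le_rfl⟩, z * (D.toDualVar m).ω - ε • x, ?_, ?_,
    ?_, ?_, ?_, ?_, ?_, le_rfl⟩
  · simp only [m, smul_eq_mul]
    rw [bordered_smul]
    exact h₁.smul (by positivity)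
  · simpa [m] using h₂
  · simp
  · change ε • V + (ε • V)ᵀ = _
    simp only [m, transpose_smul]
    module
  · change ε • U + (ε • U)ᵀ = _
    simp only [m, havg, hG, transpose_add, transpose_sub, transpose_smul, transpose_vecMulVec,
      transpose_transpose, add_vecMulVec, smul_vecMulVec, hcovs]
    module
  · change ε • p = _
    simp only [m]
    module
  · change ε • q = _
    simp only [m, havg]
    module
  · change ε * r = _
    simp only [m, havg]
    ring
  · change ε * s = _
    simp only [m]
    ring

/-- A primal point at which the Lagrange function is at most the dual bound for all admissible
multipliers. -/
theorem exists_forall_lagrangian_le {D : Data N M L} {k : ℕ} {z : Fin N → ℝ} {val : ℝ} (hL : 1 ≤ L)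
    (hγ : 0 < D.γ) (hκ₁ : 0 < D.κ₁) (hκ₂ : 1 ≤ D.κ₂) (hcov : D.cov.PosDef)
    (hz : z ∈ selections N k) (hval : ∀ d ∈ D.dualFeasible, D.dualObj z d ≤ val) :
    ∃ v : PrimalVar N, ∀ m ∈ admissible N L, D.lagrangian z v m ≤ val := by
  have hcovs : D.covᵀ = D.cov := hcov.isHermitian
  obtain ⟨f, hf⟩ := exists_multiplier (convex_coeffSet hγ z val)
    (fun t => nonneg_of_zero_mem_coeffSet hcovs hz hval)
    (exists_smul_mem_coeffSet hL hκ₁ hκ₂ hcov z val)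
  obtain ⟨x, V, U, p, q, r, s, hfw⟩ := exists_coeffSpace_functional_eq f
  refine ⟨⟨x, (1 / 2 : ℝ) • (V + Vᵀ), (1 / 2 : ℝ) • (U + Uᵀ), p, q, r, s,
    by rw [IsSymm, transpose_smul, transpose_add, transpose_transpose, add_comm],
    by rw [IsSymm, transpose_smul, transpose_add, transpose_transpose, add_comm]⟩, fun m hm => ?_⟩
  have hLam : m.Lamᵀ = m.Lam := (bordered_posSemidef_iff.1 hm.2.1).1
  set C := D.κ₂ • D.cov - vecMulVec D.μ D.μ - vecMulVec m.α D.μ - ∑ l, m.B l with hC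
  -- At `u = x / γ` the conjugate term becomes `-1/(2γ) x ⬝ x`.
  have h := hf (z * (D.toDualVar m).ω - D.γ⁻¹ • x, m.Lam - D.cov, (-(1 / 2) : ℝ) • (C + Cᵀ),
    (2 : ℝ) • D.μ + m.α + (2 : ℝ) • m.lam, (1 / 2 : ℝ) • m.α + ∑ l, m.β l, ∑ l, m.η l - 1,
    m.ν - D.κ₁) _ ⟨m, hm, D.γ⁻¹ • x, rfl, by
      simp only [transpose_sub, hLam, hcovs]; module, by
      simp only [hC, transpose_add, transpose_sub, transpose_smul, transpose_vecMulVec,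
        transpose_transpose, hcovs]
      module, rfl, rfl, rfl, rfl, le_rfl⟩
  rw [hfw] at h
  have hQ : matInner ((-(1 / 2) : ℝ) • (C + Cᵀ)) U = - matInner C ((1 / 2 : ℝ) • (U + Uᵀ)) := by
    rw [matInner_smul_left, matInner_smul_right, matInner_add_transpose_left]; ring
  have hP : matInner (m.Lam - D.cov) V
      = - matInner (D.cov - m.Lam) ((1 / 2 : ℝ) • (V + Vᵀ)) := by
    have h1 : m.Lam - D.cov = (-(1 / 2) : ℝ) • ((D.cov - m.Lam) + (D.cov - m.Lam)ᵀ) := by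
      simp only [transpose_sub, hLam, hcovs]; module
    rw [h1, matInner_smul_left, matInner_smul_right, matInner_add_transpose_left]; ring
  have hx : D.γ / 2 * ((D.γ⁻¹ • x) ⬝ᵥ (D.γ⁻¹ • x)) + (z * (D.toDualVar m).ω - D.γ⁻¹ • x) ⬝ᵥ x
      = x ⬝ᵥ (z * (D.toDualVar m).ω) - 1 / (2 * D.γ) * (x ⬝ᵥ x) := by
    rw [sub_dotProduct, dotProduct_comm (z * _) x]
    simp only [smul_dotProduct, dotProduct_smul, smul_eq_mul]
    field_simp
    ring
  rw [D.lagrangian_eq]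
  simp only [hQ, hP] at h
  simp only [← hC]
  linarith

/-- As multipliers range over a cone, a primal point with Lagrange function at most `val` for all
of them is feasible, and its objective is at most `val`. -/
theorem mem_primalFeasible_of_forall_lagrangian_le {D : Data N M L} {z : Fin N → ℝ} {val : ℝ}
    {v : PrimalVar N} (h : ∀ m ∈ admissible N L, D.lagrangian z v m ≤ val) :
    v ∈ D.primalFeasible z ∧ D.primalObj v ≤ val := by
  have h0 : (bordered (0 : Matrix (Fin N) (Fin N) ℝ) 0 0).PosSemidef := by
    rw [bordered_zero]; exact PosSemidef.zero
  have hα : v.p + (1 / 2 : ℝ) • v.q + v.Q *ᵥ D.μ = 0 := dotProduct_self_eq_zero.1 <|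
    eq_zero_of_forall_le_add_mul (K := -val) (c := -D.primalObj v) fun t => by
      have := h ⟨t • (v.p + (1 / 2 : ℝ) • v.q + v.Q *ᵥ D.μ), 0, 0, 0, 0, 0, 0, 0, 0⟩
        ⟨fun _ => h0, h0, fun _ => le_rfl⟩
      simp only [lagrangian, Pi.zero_apply, bordered_zero, matInner_zero_left, smul_dotProduct,
        zero_dotProduct, Finset.sum_const_zero, smul_eq_mul] at this
      linarith
  have hπ : ∑ n, (diagonal z *ᵥ v.x) n - 1 = 0 :=
    eq_zero_of_forall_le_add_mul (K := -val) (c := -D.primalObj v) fun t => by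
      have := h ⟨0, 0, 0, 0, 0, 0, 0, t, 0⟩ ⟨fun _ => h0, h0, fun _ => le_rfl⟩
      simp only [lagrangian, Pi.zero_apply, bordered_zero, matInner_zero_left, zero_dotProduct,
        Finset.sum_const_zero] at this
      linarith
  have hobj : D.primalObj v ≤ val := by
    have := h ⟨0, 0, 0, 0, 0, 0, 0, 0, 0⟩ ⟨fun _ => h0, h0, fun _ => le_rfl⟩
    simp only [lagrangian, Pi.zero_apply, bordered_zero, matInner_zero_left, zero_dotProduct,
      Finset.sum_const_zero, zero_mul] at this
    linarith
  refine ⟨⟨?_, fun l₀ => ?_, ?_, sub_eq_zero.1 hπ, fun n => ?_⟩, hobj⟩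
  · rw [← sub_eq_zero, ← hα]; abel
  · refine bordered_posSemidef_iff.2 ⟨v.Q_symm, fun y τ => ?_⟩
    refine nonneg_of_forall_sub_mul_le (c := D.primalObj v) (K := val) fun t ht => ?_
    have hb : ∀ l, bordered (Pi.single (M := fun _ : Fin L => Matrix (Fin N) (Fin N) ℝ) l₀
          (t • vecMulVec y y) l) (Pi.single (M := fun _ : Fin L => Fin N → ℝ) l₀ (t • τ • y) l)
          (Pi.single (M := fun _ : Fin L => ℝ) l₀ (t * τ ^ 2) l)
        = if l = l₀ then t • bordered (vecMulVec y y) (τ • y) (τ ^ 2) else 0 := fun l => by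
      split_ifs with hl
      · subst hl
        simp only [Pi.single_eq_same, bordered_smul]
      · simp only [Pi.single_eq_of_ne hl, bordered_zero]
    have := h ⟨0, Pi.single l₀ (t • vecMulVec y y), Pi.single l₀ (t • τ • y),
      Pi.single l₀ (t * τ ^ 2), 0, 0, 0, 0, 0⟩ ⟨fun l => by
        simp only [hb]
        split_ifs
        · exact (bordered_vecMulVec_posSemidef y τ).smul ht
        · exact PosSemidef.zero, h0, fun _ => le_rfl⟩
    simp only [lagrangian, hb, bordered_zero, matInner_zero_left, zero_dotProduct, zero_mul] at this
    rw [Finset.sum_eq_single l₀ (fun l _ hl => by rw [if_neg hl, matInner_zero_left])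
      (fun hl => absurd (Finset.mem_univ _) hl), if_pos rfl, matInner_smul_left, utilityBlock,
      matInner_bordered, matInner_vecMulVec, smul_dotProduct, smul_eq_mul,
      dotProduct_comm y (_ + _)] at this
    linarith
  · refine bordered_posSemidef_iff.2 ⟨v.P_symm, fun y τ => ?_⟩
    refine nonneg_of_forall_sub_mul_le (c := D.primalObj v) (K := val) fun t ht => ?_
    have := h ⟨0, 0, 0, 0, t • vecMulVec y y, t • τ • y, t * τ ^ 2, 0, 0⟩ ⟨fun _ => h0, by
        rw [bordered_smul]; exact (bordered_vecMulVec_posSemidef y τ).smul ht, fun _ => le_rfl⟩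
    simp only [lagrangian, Pi.zero_apply, bordered_zero, bordered_smul, matInner_zero_left,
      matInner_smul_left, matInner_bordered, matInner_vecMulVec, zero_dotProduct, zero_mul,
      Finset.sum_const_zero, smul_dotProduct, smul_eq_mul, dotProduct_comm y v.p] at this
    linarith
  · refine nonneg_of_forall_sub_mul_le (c := D.primalObj v) (K := val) fun t ht => ?_
    have := h ⟨0, 0, 0, 0, 0, 0, 0, 0, t • Pi.single n 1⟩ ⟨fun _ => h0, h0, fun i => by
      rcases eq_or_ne i n with rfl | hi <;> simp [*]⟩
    simp only [lagrangian, Pi.zero_apply, bordered_zero, matInner_zero_left, zero_dotProduct,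
      Finset.sum_const_zero, zero_mul, smul_dotProduct, single_one_dotProduct,
      smul_eq_mul] at this
    linarith

end Data

end DRPortfolio

theorem theorem1 {N M L k : ℕ} (D : DRPortfolio.Data N M L)
    (hL : 1 ≤ L) (hk : 1 ≤ k) (hkN : k ≤ N)
    (hγ : 0 < D.γ) (hκ₂ : 1 ≤ D.κ₂)
    (hκ₁ : 0 < D.κ₁) (hcov : D.cov.PosDef)
    (z : Fin N → ℝ) (hz : z ∈ DRPortfolio.selections N k) :
    -- the lower-level problem and the explicit dual attain the common optimal value `f(z)`
    (IsLeast (D.primalObj '' D.primalFeasible z) (D.lowerValue z) ∧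
      IsGreatest (D.dualObj z '' D.dualFeasible) (D.lowerValue z)) ∧
    -- so does the Lagrange dual of the lower-level problem
    IsGreatest (D.lagrangeDual z '' DRPortfolio.admissible N L) (D.lowerValue z : EReal) ∧
    -- and the explicit dual represents the Lagrange dual
    Set.BijOn D.toDualVar {m ∈ DRPortfolio.admissible N L | D.lagrangeDual z m ≠ ⊥}
      D.dualFeasible ∧
    ∀ m ∈ DRPortfolio.admissible N L, D.lagrangeDual z m ≠ ⊥ →
      D.lagrangeDual z m = (D.dualObj z (D.toDualVar m) : EReal) := by
  open DRPortfolio DRPortfolio.Data in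
  have hsymm : D.cov.IsSymm := hcov.isHermitian
  have hst : ∀ m ∈ admissible N L, D.lagrangeDual z m ≠ ⊥ → D.Stationary m :=
    fun m hm h => stationary_of_lagrangeDual_ne_bot hsymm hm h
  have heq : ∀ m ∈ admissible N L, D.lagrangeDual z m ≠ ⊥ →
      D.lagrangeDual z m = (D.dualObj z (D.toDualVar m) : EReal) :=
    fun m hm h => (hst m hm h).lagrangeDual_eq hγ hz
  have hlift : ∀ d ∈ D.dualFeasible, D.lagrangeDual z (D.liftDual d) = (D.dualObj z d : EReal) :=
    fun d hd => by rw [(stationary_liftDual hd).lagrangeDual_eq hγ hz, toDualVar_liftDual]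
  obtain ⟨d, hd, hmax⟩ := exists_isMaxOn_dualObj hL hk hγ hκ₁ hκ₂ hcov hz
  obtain ⟨v, hv⟩ := exists_forall_lagrangian_le hL hγ hκ₁ hκ₂ hcov hz (fun d hd => hmax hd)
  obtain ⟨hvf, hvle⟩ := mem_primalFeasible_of_forall_lagrangian_le hv
  have hle : ∀ v' ∈ D.primalFeasible z, D.dualObj z d ≤ D.primalObj v' :=
    fun v' hv' => dualObj_le_primalObj hγ hz hv' hd
  have hleast : IsLeast (D.primalObj '' D.primalFeasible z) (D.dualObj z d) :=
    ⟨⟨v, hvf, hvle.antisymm (hle v hvf)⟩, Set.forall_mem_image.2 hle⟩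
  have hval : D.lowerValue z = D.dualObj z d := hleast.csInf_eq
  rw [hval]
  refine ⟨⟨hleast, ⟨d, hd, rfl⟩, Set.forall_mem_image.2 fun d' hd' => hmax hd'⟩,
    ⟨⟨D.liftDual d, liftDual_mem_admissible hd, hlift d hd⟩, Set.forall_mem_image.2 fun m hm => ?_⟩,
    ⟨fun m hm => (hst m hm.1 hm.2).toDualVar_mem hm.1, fun m hm m' hm' h => ?_, fun d' hd' =>
      ⟨D.liftDual d', ⟨liftDual_mem_admissible hd', ?_⟩, toDualVar_liftDual D d'⟩⟩, heq⟩
  · by_cases h : D.lagrangeDual z m = ⊥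
    · rw [h]; exact bot_le
    · rw [heq m hm h, EReal.coe_le_coe_iff]
      exact hmax ((hst m hm h).toDualVar_mem hm)
  · rw [← (hst m hm.1 hm.2).liftDual_toDualVar, h, (hst m' hm'.1 hm'.2).liftDual_toDualVar]
  · rw [hlift d' hd']
    exact EReal.coe_ne_bot _
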